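/- Let $\tilde G$ be the universal covering group of $SU(1,1)$, acting on the unit disc $\mathbb D$ by $g\cdot z=(az+b)/(cz+d)$, let $c_g$ be the lower left entry of the image of $g\in\tilde G$ in $SU(1,1)$, and let $g'(z)^s$ be the branch of the power of $g'(z)=(cz+d)^{-2}$ on $\tilde G\times\mathbb D$ that is $1$ at the identity. Let $m\ge 0$, $d_0,\dots,d_m\ge 1$, $\mathbb C^d=\mathbb C^{d_0}\oplus\cdots\oplus\mathbb C^{d_m}$, $\eta\in\mathbb R$, and let $Y$ be a block subdiagonal matrix on $\mathbb C^d$, that is, its only possibly nonzero blocks are $Y_j:\mathbb C^{d_{j-1}}\to\mathbb C^{d_j}$, $1\le j\le m$. The elementary homogeneous holomorphic bundle $E^{(\eta,Y)}$ (holomorphically induced by $\varrho(h)=-(\eta+j)$ on $\mathbb C^{d_j}$, $\varrho(y)=Y$) is, in its canonical trivialization, $\mathbb D\times\mathbb C^d$ where $g\in\tilde G$ maps the fibre over $z$ to the fibre over $g\cdot z$ by $J_g(z)^{-1}$, with $$J_g(z)=J_g^{(\eta,Y)}(z)=g'(z)^{\eta}\,D_g(z)\exp(-c_gY)D_g(z),\qquad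 D_g(z)=g'(z)^{j/2}\ \text{ on } \mathbb C^{d_j}.$$ For a positive definite block diagonal matrix $H$ on $\mathbb C^d$, $(E^{(\eta,Y)},H)$ denotes this bundle with the unique $\tilde G$-invariant Hermitian structure $\|\xi\|_z^2=\langle H(z)\xi,\xi\rangle$ with $H(0)=H$ (invariance means $H(g\cdot z)=J_g(z)^*H(z)J_g(z)$). Let $(E^{(\eta',Y')},H')$ be a second such bundle, with block sizes $d'_0,\dots,d'_{m'}\ge 1$. Proposition. The following are equivalent: (i) $(E^{(\eta,Y)},H)$ and $(E^{(\eta',Y')},H')$ are isomorphic as homogeneous holomorphic Hermitian vector bundles, that is, by a holomorphic, fibrewise linear isometric bundle isomorphism over the identity of $\mathbb D$ that commutes with the actions of $\tilde G$; (ii) $(E^{(\eta,Y)},H)$ and $(E^{(\eta',Y')},H')$ are isomorphic as holomorphic Hermitian vector bundles, that is, by an isomorphism as in (i) that is not required to commute with $\tilde G$; (iii) $\eta=\eta'$ and there is an invertible block diagonal matrix $A$, that is, an invertible linear map $A:\bigoplus_j\mathbb C^{d_j}\to\bigoplus_j\mathbb C^{d'_j}$ which maps $\mathbb C^{d_j}$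 into $\mathbb C^{d'_j}$ for every $j$ (a space whose index is out of range being $0$; so necessarily $m=m'$ and $d_j=d'_j$ for all $j$), such that $$Y'=AYA^{-1},\qquad H'=(A^{*})^{-1}HA^{-1}.$$ -/

import Mathlib

open scoped ComplexOrder

noncomputable section

namespace HomBundle

open scoped Complex.UnitDisc ComplexConjugate ContDiff

/-- A function on the unit disc is holomorphic (it is the restriction to `𝔻` of a function that is
complex differentiable on the open unit disc; the values outside the disc are irrelevant). -/
def IsHolomorphic (f : 𝔻 → ℂ) : Prop :=
  ∃ F : ℂ → ℂ, DifferentiableOn ℂ F (Metric.ball 0 1) ∧ ∀ z : 𝔻, F z = f z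

/-- A complex-valued function on the unit disc is `C^∞` in the real sense. -/
def IsSmooth (f : 𝔻 → ℂ) : Prop :=
  ∃ F : ℂ → ℂ, ContDiffOn ℝ ∞ F (Metric.ball 0 1) ∧ ∀ z : 𝔻, F z = f z

/-! ### The group `SU(1,1)` and its action on the disc -/

/-- `SU(1,1)`, as a subgroup of `SL(2,ℂ)`: the matrices `[[a, b], [conj b, conj a]]` of
determinant one. -/
def su11 : Subgroup (Matrix.SpecialLinearGroup (Fin 2) ℂ) where
  carrier := {g | g 1 0 = conj (g 0 1) ∧ g 1 1 = conj (g 0 0)}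
  one_mem' := by simp
  mul_mem' := by
    rintro g h ⟨hg, hg'⟩ ⟨hh, hh'⟩
    simp only [Set.mem_ofPred_eq, Matrix.SpecialLinearGroup.coe_mul, Matrix.mul_apply,
      Fin.sum_univ_two, hg, hg', hh, hh', map_add, map_mul, Complex.conj_conj]
    exact ⟨by ring, by ring⟩
  inv_mem' := by
    rintro g ⟨hg, hg'⟩
    simp [Matrix.SpecialLinearGroup.coe_inv, Matrix.adjugate_fin_two, hg, hg']

/-- The group `SU(1,1)`. -/
abbrev SU11 : Type := su11

namespace SU11

/-! The four entries of an element `[[a, b], [c, d]]` of `SU(1,1)`. -/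

def a (g : SU11) : ℂ := g.1 0 0
def b (g : SU11) : ℂ := g.1 0 1
def c (g : SU11) : ℂ := g.1 1 0
def d (g : SU11) : ℂ := g.1 1 1

theorem c_eq (g : SU11) : g.c = conj g.b := g.2.1
theorem d_eq (g : SU11) : g.d = conj g.a := g.2.2

theorem det_eq (g : SU11) : g.a * g.d - g.b * g.c = 1 := by
  have := g.1.2
  rwa [Matrix.det_fin_two] at this

theorem normSq_eq (g : SU11) : Complex.normSq g.a - Complex.normSq g.b = 1 := by
  have h := g.det_eq
  rw [c_eq, d_eq, Complex.mul_conj, Complex.mul_conj] at h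
  exact_mod_cast h

@[simp] theorem a_one : (1 : SU11).a = 1 := by simp [a]
@[simp] theorem b_one : (1 : SU11).b = 0 := by simp [b]
@[simp] theorem c_one : (1 : SU11).c = 0 := by simp [c]
@[simp] theorem d_one : (1 : SU11).d = 1 := by simp [d]

theorem a_mul (g h : SU11) : (g * h).a = g.a * h.a + g.b * h.c := by
  simp [a, b, c, Matrix.mul_apply, Fin.sum_univ_two]
theorem b_mul (g h : SU11) : (g * h).b = g.a * h.b + g.b * h.d := by
  simp [a, b, d, Matrix.mul_apply, Fin.sum_univ_two]
theorem c_mul (g h : SU11) : (g * h).c = g.c * h.a + g.d * h.c := by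
  simp [a, c, d, Matrix.mul_apply, Fin.sum_univ_two]
theorem d_mul (g h : SU11) : (g * h).d = g.c * h.b + g.d * h.d := by
  simp [b, c, d, Matrix.mul_apply, Fin.sum_univ_two]

/-- `|c w + d|² - |a w + b|² = 1 - |w|²`. -/
theorem normSq_sub (g : SU11) (w : ℂ) :
    Complex.normSq (g.c * w + g.d) - Complex.normSq (g.a * w + g.b) = 1 - Complex.normSq w := by
  have h := g.normSq_eq
  rw [c_eq, d_eq]
  simp only [Complex.normSq_apply, Complex.add_re, Complex.add_im, Complex.mul_re, Complex.mul_im,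
    Complex.conj_re, Complex.conj_im] at h ⊢
  linear_combination (1 - w.re * w.re - w.im * w.im) * h

theorem normSq_pos (g : SU11) {w : ℂ} (hw : ‖w‖ < 1) :
    0 < Complex.normSq (g.c * w + g.d) - Complex.normSq (g.a * w + g.b) := by
  rw [normSq_sub, Complex.normSq_eq_norm_sq]
  nlinarith [norm_nonneg w]

theorem denom_ne (g : SU11) {w : ℂ} (hw : ‖w‖ < 1) : g.c * w + g.d ≠ 0 := by
  intro h
  have := g.normSq_pos hw
  rw [h, map_zero] at this
  linarith [Complex.normSq_nonneg (g.a * w + g.b)]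

theorem norm_moebius_lt (g : SU11) {w : ℂ} (hw : ‖w‖ < 1) :
    ‖(g.a * w + g.b) / (g.c * w + g.d)‖ < 1 := by
  have h := g.normSq_pos hw
  rw [norm_div, div_lt_one (norm_pos_iff.2 (g.denom_ne hw))]
  rw [Complex.normSq_eq_norm_sq, Complex.normSq_eq_norm_sq] at h
  exact lt_of_pow_lt_pow_left₀ 2 (norm_nonneg _) (by linarith)

/-- The action of `SU(1,1)` on the unit disc, `g · z = (a z + b) / (c z + d)`. -/
def moebius (g : SU11) (z : 𝔻) : 𝔻 :=
  .mk ((g.a * z + g.b) / (g.c * z + g.d)) (g.norm_moebius_lt z.norm_lt_one)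

theorem coe_moebius (g : SU11) (z : 𝔻) :
    (g.moebius z : ℂ) = (g.a * z + g.b) / (g.c * z + g.d) := rfl

/-- The cocycle identity for the factor `c z + d`. -/
theorem denom_mul (g h : SU11) (z : 𝔻) :
    (g * h).c * (z : ℂ) + (g * h).d = (g.c * h.moebius z + g.d) * (h.c * z + h.d) := by
  have := h.denom_ne z.norm_lt_one
  rw [coe_moebius, c_mul, d_mul]
  field_simp
  ring

theorem moebius_mul (g h : SU11) (z : 𝔻) : (g * h).moebius z = g.moebius (h.moebius z) := by
  apply Complex.UnitDisc.coe_injective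
  rw [coe_moebius, denom_mul, coe_moebius g]
  have h1 := h.denom_ne z.norm_lt_one
  have h2 := g.denom_ne (h.moebius z).norm_lt_one
  rw [div_eq_div_iff (mul_ne_zero h2 h1) h2, a_mul, b_mul, coe_moebius]
  field_simp
  ring

theorem moebius_one (z : 𝔻) : (1 : SU11).moebius z = z := by
  apply Complex.UnitDisc.coe_injective
  simp [coe_moebius]

end SU11

/-! ### The universal covering group of `SU(1,1)` -/

/-- The universal covering group `G̃` of `SU(1,1)` (and of the Möbius group), in its standard model:
an element is `g ∈ SU(1,1)` together with a holomorphic branch on the disc of `log (c z + d)`.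
The kernel of `(g, log) ↦ g` is the group of constants `2πiℤ`, and the stabilizer of `0` is
isomorphic to `ℝ`, so that `G̃`, a bundle over the disc with fibre `ℝ`, is simply connected. -/
@[ext] structure Cover where
  base : SU11
  log : 𝔻 → ℂ
  holo : IsHolomorphic log
  exp_log : ∀ z : 𝔻, Complex.exp (log z) = base.c * z + base.d

theorem IsHolomorphic.comp_moebius {f : 𝔻 → ℂ} (hf : IsHolomorphic f) (g : SU11) :
    IsHolomorphic fun z => f (g.moebius z) := by
  obtain ⟨F, hF, hFf⟩ := hf
  refine ⟨fun w => F ((g.a * w + g.b) / (g.c * w + g.d)), ?_, fun z => ?_⟩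
  · refine hF.comp (f := fun w => (g.a * w + g.b) / (g.c * w + g.d)) ?_ ?_
    · intro w hw
      have := g.denom_ne (mem_ball_zero_iff.1 hw)
      exact DifferentiableAt.differentiableWithinAt (by fun_prop (disch := assumption))
    · intro w hw
      exact mem_ball_zero_iff.2 (g.norm_moebius_lt (mem_ball_zero_iff.1 hw))
  · simp only [← hFf, SU11.coe_moebius]

namespace Cover

instance : One Cover where
  one :=
    { base := 1
      log := fun _ => 0
      holo := ⟨fun _ => 0, by fun_prop, fun _ => rfl⟩
      exp_log := by simp }

instance : Mul Cover where
  mul g h :=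
    { base := g.base * h.base
      log := fun z => g.log (h.base.moebius z) + h.log z
      holo := by
        obtain ⟨F, hF, hF'⟩ := g.holo.comp_moebius h.base
        obtain ⟨K, hK, hK'⟩ := h.holo
        exact ⟨fun w => F w + K w, hF.add hK, fun z => by simp only [hF', hK']⟩
      exp_log := fun z => by
        rw [Complex.exp_add, g.exp_log, h.exp_log, SU11.denom_mul] }

instance : Inv Cover where
  inv g :=
    { base := g.base⁻¹
      log := fun z => - g.log (g.base⁻¹.moebius z)
      holo := by
        obtain ⟨F, hF, hF'⟩ := g.holo.comp_moebius g.base⁻¹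
        exact ⟨fun w => - F w, hF.neg, fun z => by simp only [hF']⟩
      exp_log := fun z => by
        have h := SU11.denom_mul g.base g.base⁻¹ z
        rw [mul_inv_cancel, SU11.c_one, SU11.d_one, zero_mul, zero_add] at h
        rw [Complex.exp_neg, g.exp_log]
        exact (eq_inv_of_mul_eq_one_right h.symm).symm }

@[simp] theorem base_one : (1 : Cover).base = 1 := rfl
@[simp] theorem log_one (z : 𝔻) : (1 : Cover).log z = 0 := rfl
@[simp] theorem base_mul (g h : Cover) : (g * h).base = g.base * h.base := rfl
@[simp] theorem log_mul (g h : Cover) (z : 𝔻) :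
    (g * h).log z = g.log (h.base.moebius z) + h.log z := rfl
@[simp] theorem base_inv (g : Cover) : g⁻¹.base = g.base⁻¹ := rfl
@[simp] theorem log_inv (g : Cover) (z : 𝔻) : g⁻¹.log z = - g.log (g.base⁻¹.moebius z) := rfl

instance : Group Cover :=
  Group.ofLeftAxioms
    (fun g h k => by
      ext z
      · simp [mul_assoc]
      · simp [SU11.moebius_mul, add_assoc])
    (fun g => by
      ext z <;> simp)
    (fun g => by
      ext z
      · simp
      · simp [← SU11.moebius_mul, SU11.moebius_one])

instance : MulAction Cover 𝔻 where
  smul g z := g.base.moebius z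
  one_smul := SU11.moebius_one
  mul_smul g h z := SU11.moebius_mul g.base h.base z

theorem smul_def (g : Cover) (z : 𝔻) : g • z = g.base.moebius z := rfl

/-- The power `g'(z)^s` of the derivative `g'(z) = (c z + d)⁻²` of `z ↦ g · z`, on `G̃ × 𝔻`, with
the branch that is `1` at the identity. -/
def derivPow (g : Cover) (s : ℂ) (z : 𝔻) : ℂ := Complex.exp (-2 * s * g.log z)

/-- `g'(z)^1` is the derivative of the action. -/
theorem hasDerivAt_moebius (g : Cover) (z : 𝔻) :
    HasDerivAt (fun w : ℂ => (g.base.a * w + g.base.b) / (g.base.c * w + g.base.d))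
      (g.derivPow 1 z) z := by
  have hne := g.base.denom_ne z.norm_lt_one
  have hdet := g.base.det_eq
  have h1 : HasDerivAt (fun w : ℂ => g.base.a * w + g.base.b) g.base.a z := by
    simpa using ((hasDerivAt_id (z : ℂ)).const_mul g.base.a).add_const g.base.b
  have h2 : HasDerivAt (fun w : ℂ => g.base.c * w + g.base.d) g.base.c z := by
    simpa using ((hasDerivAt_id (z : ℂ)).const_mul g.base.c).add_const g.base.d
  refine (h1.div h2 hne).congr_deriv ?_
  have : g.derivPow 1 z = (Complex.exp (g.log z) ^ 2)⁻¹ := by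
    rw [derivPow, ← Complex.exp_nat_mul, ← Complex.exp_neg]
    congr 1
    push_cast
    ring
  rw [this, g.exp_log, inv_eq_one_div]
  congr 1
  linear_combination hdet

/-- The canonical element `p_z ∈ G̃` with `p_z · 0 = z`: it lies over the matrix
`(1 - |z|²)^(-1/2) [[1, z], [conj z, 1]]`, and `log (c w + d)` is the branch that is real at
`w = 0`. -/
def lift (z : 𝔻) : Cover where
  base := ⟨⟨!![(↑(√(1 - ‖(z : ℂ)‖ ^ 2))⁻¹ : ℂ), ↑(√(1 - ‖(z : ℂ)‖ ^ 2))⁻¹ * z;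
      ↑(√(1 - ‖(z : ℂ)‖ ^ 2))⁻¹ * conj (z : ℂ), ↑(√(1 - ‖(z : ℂ)‖ ^ 2))⁻¹], by
        have h : (0 : ℝ) < 1 - ‖(z : ℂ)‖ ^ 2 := sub_pos.2 z.sq_norm_lt_one
        have h2 : (√(1 - ‖(z : ℂ)‖ ^ 2))⁻¹ ^ 2 * (1 - ‖(z : ℂ)‖ ^ 2) = 1 := by
          rw [inv_pow, Real.sq_sqrt h.le, inv_mul_cancel₀ h.ne']
        rw [Matrix.det_fin_two_of]
        have h3 := Complex.mul_conj (z : ℂ)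
        rw [Complex.normSq_eq_norm_sq] at h3
        have h4 : ((↑(√(1 - ‖(z : ℂ)‖ ^ 2))⁻¹ : ℂ)) ^ 2 * (1 - (↑(‖(z : ℂ)‖ ^ 2) : ℂ)) = 1 := by
          exact_mod_cast h2
        linear_combination h4 - ((↑(√(1 - ‖(z : ℂ)‖ ^ 2))⁻¹ : ℂ)) ^ 2 * h3⟩, by
    show _ ∧ _
    simp⟩
  log w := ↑(-(1 / 2) * Real.log (1 - ‖(z : ℂ)‖ ^ 2)) + Complex.log (1 + conj (z : ℂ) * w)
  holo := by
    refine ⟨fun w => ↑(-(1 / 2) * Real.log (1 - ‖(z : ℂ)‖ ^ 2)) +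
      Complex.log (1 + conj (z : ℂ) * w), ?_, fun _ => rfl⟩
    refine DifferentiableOn.const_add _ (DifferentiableOn.clog (by fun_prop) fun w hw => ?_)
    refine Complex.mem_slitPlane_of_norm_lt_one ?_
    rw [norm_mul, RCLike.norm_conj]
    have := mem_ball_zero_iff.1 hw
    nlinarith [norm_nonneg w, z.norm_lt_one, norm_nonneg (z : ℂ)]
  exp_log w := by
    have h : (0 : ℝ) < 1 - ‖(z : ℂ)‖ ^ 2 := sub_pos.2 z.sq_norm_lt_one
    have hne : 1 + conj (z : ℂ) * (w : ℂ) ≠ 0 := by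
      refine Complex.slitPlane_ne_zero (Complex.mem_slitPlane_of_norm_lt_one ?_)
      rw [norm_mul, RCLike.norm_conj]
      nlinarith [norm_nonneg (w : ℂ), z.norm_lt_one, norm_nonneg (z : ℂ), w.norm_lt_one]
    have h2 : Real.exp (-(1 / 2) * Real.log (1 - ‖(z : ℂ)‖ ^ 2)) =
        (√(1 - ‖(z : ℂ)‖ ^ 2))⁻¹ := by
      rw [Real.sqrt_eq_rpow, ← Real.rpow_neg h.le, Real.rpow_def_of_pos h, mul_comm]
    rw [Complex.exp_add, Complex.exp_log hne, ← Complex.ofReal_exp, h2]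
    simp only [SU11.c, SU11.d, Matrix.of_apply, Matrix.cons_val_one, Matrix.cons_val_zero,
      Matrix.cons_val', Matrix.cons_val_fin_one]
    ring

theorem lift_smul_zero (z : 𝔻) : lift z • (0 : 𝔻) = z := by
  apply Complex.UnitDisc.coe_injective
  have h : (0 : ℝ) < 1 - ‖(z : ℂ)‖ ^ 2 := sub_pos.2 z.sq_norm_lt_one
  have h1 : ((√(1 - ‖(z : ℂ)‖ ^ 2) : ℝ) : ℂ) ≠ 0 := by
    exact_mod_cast (Real.sqrt_pos.2 h).ne'
  rw [smul_def, SU11.coe_moebius]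
  simp [SU11.a, SU11.b, SU11.c, SU11.d, lift]
  field_simp

end Cover

/-! ### Homogeneous holomorphic Hermitian vector bundles -/

/-- A `G̃`-homogeneous holomorphic Hermitian vector bundle over the disc, in a global holomorphic
trivialization `E = 𝔻 × ℂ^ι`. The bundle map `g_z : E_z → E_{gz}` of `g ∈ G̃` is the matrix
`(J_g(z))⁻¹`, and the Hermitian structure is `‖ξ‖_z² = ⟨H(z) ξ, ξ⟩`. -/
structure HermBundle (ι : Type*) [Fintype ι] [DecidableEq ι] where
  /-- the multiplier `J_g(z)` -/
  J : Cover → 𝔻 → Matrix ι ι ℂ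
  J_holo : ∀ g p q, IsHolomorphic fun z => J g z p q
  J_one : ∀ z, J 1 z = 1
  J_mul : ∀ h g z, J (h * g) z = J g z * J h (g • z)
  /-- the Hermitian structure `H(z)` -/
  H : 𝔻 → Matrix ι ι ℂ
  H_smooth : ∀ p q, IsSmooth fun z => H z p q
  H_posDef : ∀ z, (H z).PosDef
  /-- `G̃` acts by isometries of the fibres. -/
  H_inv : ∀ g z, H (g • z) = (J g z).conjTranspose * H z * J g z

namespace HermBundle

variable {ι κ : Type*} [Fintype ι] [DecidableEq ι] [Fintype κ] [DecidableEq κ]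

/-- `Φ` is an isomorphism of holomorphic Hermitian vector bundles `E → E'` over the disc: a
holomorphic family of invertible linear maps `Φ(z) : E_z → E'_z` that are isometric. -/
def IsIsometricIso (E : HermBundle ι) (E' : HermBundle κ) (Φ : 𝔻 → Matrix κ ι ℂ) : Prop :=
  (∀ p q, IsHolomorphic fun z => Φ z p q) ∧
  (∀ z, ∃ Ψ : Matrix ι κ ℂ, Ψ * Φ z = 1 ∧ Φ z * Ψ = 1) ∧
  ∀ z, (Φ z).conjTranspose * E'.H z * Φ z = E.H z

/-- `Φ` intertwines the actions of `G̃`, that is `Φ(gz) ∘ g_z = g'_z ∘ Φ(z)` where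
`g_z = J_g(z)⁻¹` and `g'_z = J'_g(z)⁻¹`. -/
def IsEquivariant (E : HermBundle ι) (E' : HermBundle κ) (Φ : 𝔻 → Matrix κ ι ℂ) : Prop :=
  ∀ g z, E'.J g z * Φ (g • z) = Φ z * E.J g z

/-- `E` and `E'` are isomorphic as holomorphic Hermitian vector bundles. -/
def HermitianIsomorphic (E : HermBundle ι) (E' : HermBundle κ) : Prop :=
  ∃ Φ, IsIsometricIso E E' Φ

/-- `E` and `E'` are isomorphic as homogeneous holomorphic Hermitian vector bundles. -/
def HomogeneousIsomorphic (E : HermBundle ι) (E' : HermBundle κ) : Prop :=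
  ∃ Φ, IsIsometricIso E E' Φ ∧ IsEquivariant E E' Φ

end HermBundle

/-! ### The bundles `(E^(η,Y), H)` -/

/-- The index set of the standard basis of `ℂ^d = ℂ^{d_0} ⊕ ⋯ ⊕ ℂ^{d_m}`: a block `j ∈ {0,…,m}`
and an index in that block. -/
abbrev BlockIndex (m : ℕ) (d : Fin (m + 1) → ℕ) : Type := (j : Fin (m + 1)) × Fin (d j)

section Elementary

variable {m : ℕ} {d : Fin (m + 1) → ℕ} {m' : ℕ} {d' : Fin (m' + 1) → ℕ}

/-- `A : ⊕ ℂ^{d_j} → ⊕ ℂ^{d'_j}` is block diagonal: it maps `ℂ^{d_j}` to `ℂ^{d'_j}`. -/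
def IsBlockDiagonal (A : Matrix (BlockIndex m' d') (BlockIndex m d) ℂ) : Prop :=
  ∀ p q, (p.1 : ℕ) ≠ q.1 → A p q = 0

/-- `Y` is a block subdiagonal matrix: its only blocks that may be nonzero are
`Y_j : ℂ^{d_{j-1}} → ℂ^{d_j}`, `1 ≤ j ≤ m`. -/
def IsBlockSubdiagonal (Y : Matrix (BlockIndex m d) (BlockIndex m d) ℂ) : Prop :=
  ∀ p q, (p.1 : ℕ) ≠ q.1 + 1 → Y p q = 0

/-- The block scalar matrix with blocks `s ^ j`. -/
def blockPow (m : ℕ) (d : Fin (m + 1) → ℕ) (s : ℂ) :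
    Matrix (BlockIndex m d) (BlockIndex m d) ℂ :=
  Matrix.diagonal fun p => s ^ (p.1 : ℕ)

/-- The multiplier `J_g^{(η,Y)}(z) = g'(z)^η D_g(z) exp (-c_g Y) D_g(z)`, where `D_g(z)` is
diagonal, equal to `(c z + d)^{-j} = g'(z)^{j/2}` on the block `j`; this is the multiplier of the
bundle holomorphically induced by `ϱ(h) = -(η + j)` on the block `j` and `ϱ(y) = Y`. -/
def multiplier (η : ℝ) (Y : Matrix (BlockIndex m d) (BlockIndex m d) ℂ) (g : Cover) (z : 𝔻) :
    Matrix (BlockIndex m d) (BlockIndex m d) ℂ :=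
  g.derivPow η z • (blockPow m d (g.base.c * z + g.base.d)⁻¹ * NormedSpace.exp (-g.base.c • Y) *
    blockPow m d (g.base.c * z + g.base.d)⁻¹)

theorem blockPow_mul (s t : ℂ) : blockPow m d s * blockPow m d t = blockPow m d (s * t) := by
  simp [blockPow, Matrix.diagonal_mul_diagonal, mul_pow]

theorem blockPow_one : blockPow m d 1 = 1 := by simp [blockPow]

theorem blockPow_mul_subdiagonal {Y : Matrix (BlockIndex m d) (BlockIndex m d) ℂ}
    (hY : IsBlockSubdiagonal Y) (s : ℂ) : blockPow m d s * Y = s • (Y * blockPow m d s) := by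
  ext p q
  rw [blockPow, Matrix.diagonal_mul, Matrix.smul_apply, Matrix.mul_diagonal, smul_eq_mul]
  by_cases h : (p.1 : ℕ) = q.1 + 1
  · rw [h]; ring
  · rw [hY p q h]; ring

theorem blockPow_mul_exp {Y : Matrix (BlockIndex m d) (BlockIndex m d) ℂ}
    (hY : IsBlockSubdiagonal Y) {s : ℂ} (hs : s ≠ 0) (t : ℂ) :
    blockPow m d s * NormedSpace.exp (t • Y) =
      NormedSpace.exp ((s * t) • Y) * blockPow m d s := by
  have h1 : blockPow m d s * blockPow m d s⁻¹ = 1 := by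
    rw [blockPow_mul, mul_inv_cancel₀ hs, blockPow_one]
  have h2 : blockPow m d s⁻¹ * blockPow m d s = 1 := by
    rw [blockPow_mul, inv_mul_cancel₀ hs, blockPow_one]
  have h := Matrix.exp_units_conj ⟨blockPow m d s, blockPow m d s⁻¹, h1, h2⟩ (t • Y)
  simp only [Units.inv_mk] at h
  have h3 : blockPow m d s * (t • Y) * blockPow m d s⁻¹ = (s * t) • Y := by
    rw [Matrix.mul_smul, blockPow_mul_subdiagonal hY, Matrix.smul_mul, Matrix.smul_mul,
      Matrix.mul_assoc, h1, Matrix.mul_one, smul_smul, mul_comm]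
  rw [h3] at h
  rw [h, Matrix.mul_assoc, h2, Matrix.mul_one]

theorem multiplier_one (η : ℝ) (Y : Matrix (BlockIndex m d) (BlockIndex m d) ℂ) (z : 𝔻) :
    multiplier η Y 1 z = 1 := by
  simp [multiplier, Cover.derivPow, blockPow_one]

theorem multiplier_mul (η : ℝ) {Y : Matrix (BlockIndex m d) (BlockIndex m d) ℂ}
    (hY : IsBlockSubdiagonal Y) (h g : Cover) (z : 𝔻) :
    multiplier η Y (h * g) z = multiplier η Y g z * multiplier η Y h (g • z) := by
  have hg := g.base.denom_ne z.norm_lt_one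
  have hh := h.base.denom_ne (g • z).norm_lt_one
  have hp : (h * g).derivPow η z = g.derivPow η z * h.derivPow η (g • z) := by
    rw [Cover.derivPow, Cover.derivPow, Cover.derivPow, ← Complex.exp_add, Cover.log_mul,
      Cover.smul_def]
    congr 1; ring
  have hden : (h * g).base.c * (z : ℂ) + (h * g).base.d =
      (h.base.c * (g • z : 𝔻) + h.base.d) * (g.base.c * z + g.base.d) :=
    SU11.denom_mul h.base g.base z
  have hc : (h * g).base.c = g.base.c * (h.base.c * (g • z : 𝔻) + h.base.d) +
      h.base.c * (g.base.c * z + g.base.d)⁻¹ := by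
    have hdet := g.base.det_eq
    rw [Cover.base_mul, SU11.c_mul, Cover.smul_def, SU11.coe_moebius]
    field_simp
    linear_combination h.base.c * hdet
  simp only [multiplier]
  rw [hp, hden]
  generalize g.base.c * (z : ℂ) + g.base.d = u at *
  generalize h.base.c * ((g • z : 𝔻) : ℂ) + h.base.d = v at *
  rw [Matrix.smul_mul, Matrix.mul_smul, smul_smul]
  congr 1
  have e1 : NormedSpace.exp (-(h * g).base.c • Y) =
      NormedSpace.exp ((-g.base.c * v) • Y) * NormedSpace.exp ((-h.base.c * u⁻¹) • Y) := by
    rw [← Matrix.exp_add_of_commute, ← add_smul, hc]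
    · congr 2; ring
    · exact (Commute.refl Y).smul_left _ |>.smul_right _
  have e2 := blockPow_mul_exp hY (inv_ne_zero hh) (-g.base.c * v)
  rw [show v⁻¹ * (-g.base.c * v) = -g.base.c by field_simp] at e2
  have e3 := blockPow_mul_exp hY (inv_ne_zero hg) (-h.base.c)
  rw [e1, mul_inv, ← blockPow_mul, mul_comm (-h.base.c)]
  calc blockPow m d v⁻¹ * blockPow m d u⁻¹ * (NormedSpace.exp ((-g.base.c * v) • Y) *
        NormedSpace.exp ((u⁻¹ * -h.base.c) • Y)) * (blockPow m d v⁻¹ * blockPow m d u⁻¹)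
      = blockPow m d u⁻¹ * (blockPow m d v⁻¹ * NormedSpace.exp ((-g.base.c * v) • Y)) *
        (NormedSpace.exp ((u⁻¹ * -h.base.c) • Y) * blockPow m d u⁻¹) * blockPow m d v⁻¹ := by
        rw [blockPow_mul v⁻¹ u⁻¹, mul_comm v⁻¹ u⁻¹, ← blockPow_mul]
        simp only [Matrix.mul_assoc]
    _ = _ := by
        rw [e2, ← e3]
        simp only [Matrix.mul_assoc]
        rw [← Matrix.mul_assoc (blockPow m d v⁻¹) (blockPow m d u⁻¹), blockPow_mul v⁻¹ u⁻¹,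
          mul_comm v⁻¹ u⁻¹, ← blockPow_mul]
        simp only [Matrix.mul_assoc]

theorem IsHolomorphic.mul {f g : 𝔻 → ℂ} (hf : IsHolomorphic f) (hg : IsHolomorphic g) :
    IsHolomorphic fun z => f z * g z := by
  obtain ⟨F, hF, hF'⟩ := hf
  obtain ⟨K, hK, hK'⟩ := hg
  exact ⟨fun w => F w * K w, hF.mul hK, fun z => by simp only [hF', hK']⟩

theorem multiplier_apply (η : ℝ) (Y : Matrix (BlockIndex m d) (BlockIndex m d) ℂ) (g : Cover)
    (z : 𝔻) (p q : BlockIndex m d) :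
    multiplier η Y g z p q = g.derivPow η z * (((g.base.c * z + g.base.d)⁻¹ ^ (p.1 : ℕ) *
      NormedSpace.exp (-g.base.c • Y) p q) * (g.base.c * z + g.base.d)⁻¹ ^ (q.1 : ℕ)) := by
  rw [multiplier, Matrix.smul_apply, blockPow, Matrix.mul_diagonal, Matrix.diagonal_mul,
    smul_eq_mul]

theorem multiplier_holo (η : ℝ) (Y : Matrix (BlockIndex m d) (BlockIndex m d) ℂ) (g : Cover)
    (p q : BlockIndex m d) : IsHolomorphic fun z => multiplier η Y g z p q := by
  have h0 : IsHolomorphic fun z => g.derivPow η z := by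
    obtain ⟨F, hF, hF'⟩ := g.holo
    refine ⟨fun w => Complex.exp (-2 * η * F w), (hF.const_mul _).cexp, fun z => ?_⟩
    simp only [hF', Cover.derivPow]
  have h1 : ∀ n : ℕ, IsHolomorphic fun z => (g.base.c * (z : ℂ) + g.base.d)⁻¹ ^ n := by
    intro n
    refine ⟨fun w => (g.base.c * w + g.base.d)⁻¹ ^ n, fun w hw => ?_, fun z => rfl⟩
    have := g.base.denom_ne (mem_ball_zero_iff.1 hw)
    exact DifferentiableAt.differentiableWithinAt (by fun_prop (disch := assumption))
  have h2 : ∀ k : ℂ, IsHolomorphic fun _ => k := fun k => ⟨fun _ => k, by fun_prop, fun _ => rfl⟩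
  simp only [multiplier_apply]
  exact h0.mul (((h1 _).mul (h2 _)).mul (h1 _))

/-- The `G̃`-invariant Hermitian structure on `E^(η,Y)` with value `H` at `0`:
`H(z) = J_{p_z}(0)^* H J_{p_z}(0)`. -/
def metric (η : ℝ) (Y H : Matrix (BlockIndex m d) (BlockIndex m d) ℂ) (z : 𝔻) :
    Matrix (BlockIndex m d) (BlockIndex m d) ℂ :=
  (multiplier η Y (Cover.lift z) 0).conjTranspose * H * multiplier η Y (Cover.lift z) 0

theorem multiplier_isUnit (η : ℝ) {Y : Matrix (BlockIndex m d) (BlockIndex m d) ℂ}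
    (hY : IsBlockSubdiagonal Y) (g : Cover) (z : 𝔻) : IsUnit (multiplier η Y g z) := by
  have h := multiplier_mul η hY g⁻¹ g z
  rw [inv_mul_cancel, multiplier_one] at h
  exact IsUnit.of_mul_eq_one _ h.symm

theorem metric_posDef (η : ℝ) {Y H : Matrix (BlockIndex m d) (BlockIndex m d) ℂ}
    (hY : IsBlockSubdiagonal Y) (hH : H.PosDef) (z : 𝔻) : (metric η Y H z).PosDef :=
  hH.conjTranspose_mul_mul_same
    (Matrix.mulVec_injective_of_isUnit (multiplier_isUnit η hY _ _))

/-- The stabilizer of `0` acts on the fibre over `0` by isometries of any block diagonal `H`. -/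
theorem stabilizer_isometric (η : ℝ) (Y : Matrix (BlockIndex m d) (BlockIndex m d) ℂ)
    {H : Matrix (BlockIndex m d) (BlockIndex m d) ℂ} (hH : IsBlockDiagonal H) {k : Cover}
    (hk : k • (0 : 𝔻) = 0) :
    (multiplier η Y k 0).conjTranspose * H * multiplier η Y k 0 = H := by
  have hd := k.base.denom_ne (Complex.UnitDisc.norm_lt_one 0)
  rw [Complex.UnitDisc.coe_zero, mul_zero, zero_add] at hd
  have hb : k.base.b = 0 := by
    have h := congrArg (fun z : 𝔻 => (z : ℂ)) hk
    simp only [Cover.smul_def, SU11.coe_moebius, Complex.UnitDisc.coe_zero, mul_zero,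
      zero_add] at h
    exact (div_eq_zero_iff.1 h).resolve_right hd
  have hc : k.base.c = 0 := by rw [SU11.c_eq, hb, map_zero]
  have hn : ‖k.base.d‖ = 1 := by
    have h := k.base.normSq_eq
    rw [hb, map_zero, sub_zero, Complex.normSq_eq_norm_sq] at h
    rw [SU11.d_eq, RCLike.norm_conj]
    exact (pow_eq_one_iff_of_nonneg (norm_nonneg _) two_ne_zero).1 h
  have hl : (k.log 0).re = 0 := by
    have h := congrArg norm (k.exp_log 0)
    rw [Complex.norm_exp, hc, zero_mul, zero_add, hn, Real.exp_eq_one_iff] at h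
    exact h
  have hp : ‖k.derivPow η 0‖ = 1 := by
    rw [Cover.derivPow, Complex.norm_exp, Real.exp_eq_one_iff]
    simp [hl]
  have hm : multiplier η Y k 0 = Matrix.diagonal fun p : BlockIndex m d =>
      k.derivPow η 0 * k.base.d⁻¹ ^ (2 * (p.1 : ℕ)) := by
    ext p q
    rw [multiplier_apply, hc, neg_zero, zero_smul, NormedSpace.exp_zero, zero_mul, zero_add,
      Matrix.diagonal_apply, Matrix.one_apply]
    split_ifs with h
    · rw [h]; ring
    · ring
  ext p q
  rw [hm, Matrix.diagonal_conjTranspose, Matrix.mul_diagonal, Matrix.diagonal_mul]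
  by_cases h : (p.1 : ℕ) = q.1
  · have : star (k.derivPow η 0 * k.base.d⁻¹ ^ (2 * (p.1 : ℕ))) *
        (k.derivPow η 0 * k.base.d⁻¹ ^ (2 * (q.1 : ℕ))) = 1 := by
      rw [h, Complex.star_def, ← Complex.normSq_eq_conj_mul_self, Complex.normSq_eq_norm_sq]
      simp [hp, hn]
    simp only [Pi.star_apply]
    linear_combination H p q * this
  · rw [hH p q h]; ring

theorem metric_invariant (η : ℝ) {Y H : Matrix (BlockIndex m d) (BlockIndex m d) ℂ}
    (hY : IsBlockSubdiagonal Y) (hH : IsBlockDiagonal H) (g : Cover) (z : 𝔻) :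
    metric η Y H (g • z) =
      (multiplier η Y g z).conjTranspose * metric η Y H z * multiplier η Y g z := by
  set k : Cover := (Cover.lift (g • z))⁻¹ * (g * Cover.lift z) with hk
  have hk0 : k • (0 : 𝔻) = 0 := by
    rw [hk, mul_smul, mul_smul, Cover.lift_smul_zero, inv_smul_eq_iff, Cover.lift_smul_zero]
  have h1 : Cover.lift (g • z) * k = g * Cover.lift z := by rw [hk, mul_inv_cancel_left]
  have h2 := multiplier_mul η hY (Cover.lift (g • z)) k 0
  rw [h1, multiplier_mul η hY, hk0, Cover.lift_smul_zero] at h2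
  have h3 := stabilizer_isometric η Y hH (k := k⁻¹) (inv_smul_eq_iff.2 hk0.symm)
  have h4 : multiplier η Y (Cover.lift (g • z)) 0 = multiplier η Y k⁻¹ 0 *
      (multiplier η Y (Cover.lift z) 0 * multiplier η Y g z) := by
    have h5 := multiplier_mul η hY k k⁻¹ 0
    rw [mul_inv_cancel, multiplier_one, inv_smul_eq_iff.2 hk0.symm] at h5
    rw [h2, ← Matrix.mul_assoc, ← h5, Matrix.one_mul]
  rw [metric, metric, h4]
  simp only [Matrix.conjTranspose_mul, Matrix.mul_assoc] at h3 ⊢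
  rw [← Matrix.mul_assoc H, ← Matrix.mul_assoc (Matrix.conjTranspose (multiplier η Y k⁻¹ 0)),
    h3]

theorem metric_zero (η : ℝ) (Y : Matrix (BlockIndex m d) (BlockIndex m d) ℂ)
    {H : Matrix (BlockIndex m d) (BlockIndex m d) ℂ} (hH : IsBlockDiagonal H) :
    metric η Y H 0 = H :=
  stabilizer_isometric η Y hH (Cover.lift_smul_zero 0)

section Smooth

open scoped Matrix.Norms.Operator

theorem contDiff_exp_smul_apply (Y : Matrix (BlockIndex m d) (BlockIndex m d) ℂ)
    (p q : BlockIndex m d) : ContDiff ℝ ∞ fun t : ℂ => NormedSpace.exp (t • Y) p q := by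
  have h1 : Differentiable ℂ fun t : ℂ => NormedSpace.exp (t • Y) := fun t =>
    (hasDerivAt_exp_smul_const Y t).differentiableAt
  have h2 : Differentiable ℂ fun t : ℂ => NormedSpace.exp (t • Y) p q := by
    intro t
    have := differentiableAt_pi.1 (h1 t) p
    exact differentiableAt_pi.1 this q
  exact (h2.contDiff (n := ∞)).restrict_scalars ℝ

end Smooth

theorem metric_smooth (η : ℝ) (Y H : Matrix (BlockIndex m d) (BlockIndex m d) ℂ)
    (p q : BlockIndex m d) : IsSmooth fun z => metric η Y H z p q := by
  have key : ∀ p q : BlockIndex m d, ∃ F : ℂ → ℂ, ContDiffOn ℝ ∞ F (Metric.ball 0 1) ∧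
      ∀ z : 𝔻, F z = multiplier η Y (Cover.lift z) 0 p q := by
    intro p q
    refine ⟨fun w => Complex.exp (-2 * η * ↑(-(1 / 2) * Real.log (1 - ‖w‖ ^ 2))) *
      (((↑(√(1 - ‖w‖ ^ 2)) : ℂ) ^ (p.1 : ℕ) *
        NormedSpace.exp ((-(↑(√(1 - ‖w‖ ^ 2))⁻¹ * conj w)) • Y) p q) *
        (↑(√(1 - ‖w‖ ^ 2)) : ℂ) ^ (q.1 : ℕ)), ?_, fun z => ?_⟩
    · have hpos : ∀ w ∈ Metric.ball (0 : ℂ) 1, 1 - ‖w‖ ^ 2 ≠ 0 := by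
        intro w hw
        have := mem_ball_zero_iff.1 hw
        nlinarith [norm_nonneg w]
      have hpos' : ∀ w ∈ Metric.ball (0 : ℂ) 1, √(1 - ‖w‖ ^ 2) ≠ 0 := by
        intro w hw
        have := mem_ball_zero_iff.1 hw
        exact (Real.sqrt_pos.2 (by nlinarith [norm_nonneg w])).ne'
      have hn : ContDiffOn ℝ ∞ (fun w : ℂ => 1 - ‖w‖ ^ 2) (Metric.ball 0 1) :=
        (contDiff_const.sub (contDiff_norm_sq ℝ)).contDiffOn
      have hofReal : ContDiff ℝ ∞ (fun x : ℝ => (x : ℂ)) := Complex.ofRealCLM.contDiff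
      have hconj : ContDiff ℝ ∞ (fun x : ℂ => conj x) := Complex.conjCLE.contDiff
      have hs := hn.sqrt hpos
      have hs' := hofReal.comp_contDiffOn hs
      have hlog := hofReal.comp_contDiffOn (contDiffOn_const (c := -(1 / 2 : ℝ)) |>.mul
        (hn.log hpos))
      have hexp := (Complex.contDiff_exp (𝕜 := ℝ) (n := ∞)).comp_contDiffOn
        ((contDiffOn_const (c := (-2 * η : ℂ))).mul hlog)
      have hE := (contDiff_exp_smul_apply Y p q).comp_contDiffOn
        ((hofReal.comp_contDiffOn (hs.inv hpos')).mul hconj.contDiffOn).neg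
      exact hexp.mul (((hs'.pow _).mul hE).mul (hs'.pow _))
    · rw [multiplier_apply]
      simp [Cover.derivPow, Cover.lift, SU11.c, SU11.d]
  choose F hF hF' using key
  refine ⟨fun w => ∑ j, (∑ i, conj (F i p w) * H i j) * F j q w, ?_, fun z => ?_⟩
  · have hconj : ContDiff ℝ ∞ (fun x : ℂ => conj x) := Complex.conjCLE.contDiff
    exact ContDiffOn.sum fun j _ => (ContDiffOn.sum fun i _ =>
      (hconj.comp_contDiffOn (hF i p)).mul contDiffOn_const).mul (hF j q)
  · simp only [hF', metric, Matrix.mul_apply, Matrix.conjTranspose_apply, Complex.star_def]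

/-- The homogeneous holomorphic Hermitian vector bundle `(E^(η,Y), H)`, in its canonical
trivialization. -/
def bundle (η : ℝ) (Y H : Matrix (BlockIndex m d) (BlockIndex m d) ℂ)
    (hY : IsBlockSubdiagonal Y) (hH : H.PosDef) (hH' : IsBlockDiagonal H) :
    HermBundle (BlockIndex m d) where
  J := multiplier η Y
  J_holo := multiplier_holo η Y
  J_one := multiplier_one η Y
  J_mul := multiplier_mul η hY
  H := metric η Y H
  H_smooth := metric_smooth η Y H
  H_posDef := metric_posDef η hY hH
  H_inv := metric_invariant η hY hH'

end Elementary

end HomBundle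

end

/-! The substance is that an isometric isomorphism `Φ` is constrained so strongly at the origin that
`Φ 0` already intertwines the data of the two bundles. Let `M` be the block scalar matrix with
blocks `η + j` and `W` the `H`-adjoint of `Y`, so that `[M, Y] = Y` and `[M, W] = -W`; primes denote
the second bundle.

The value `J_{p_z}(0)` of the multiplier is a frame in which the metric is the constant `H`. In
these frames `Φ` becomes a function `φ` with `φ 0 = Φ 0`. Holomorphy prescribes `∂̄φ`, and isometry
then prescribes `∂φ` as its adjoint counterpart (`isParallel_of_isometric`). Equality of the mixed
derivatives shows that every `φ z` intertwines the curvatures `2M + [Y, W]` and `2M' + [Y', W']`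
(`IsParallel.curvature`). Differentiating an intertwining relation of pure weight gives intertwining
relations for the commutators with `Y` and with `W` (`IsParallel.commutator`).

Let `𝒦` be the space of all matrices `C` satisfying every relation of pure weight that `φ`
satisfies. It contains `φ 0` and is stable under `y : C ↦ Y'C - CY`, `w : C ↦ W'C - CW` and `m : C ↦
M'C - CM`. On `𝒦` the curvature relation reads `2m = [w, y]`, and `[m, y] = y`. For the
Hilbert–Schmidt product defined by `H` and `H'`, `w` is the adjoint of `y` and `m` is self-adjoint.
This is a finite-dimensional unitary representation of `𝔰𝔲(1,1)`, so `y = m = 0`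
(`eq_zero_of_su11_relations`, `intertwines_of_stable`). Thus `Y' Φ(0) = Φ(0) Y` and `M' Φ(0) = Φ(0)
M`; comparing eigenvalues of `M` and `M'` gives `η = η'` and block diagonality. Conversely, a
constant intertwiner that is isometric at the origin is an equivariant isometry everywhere. -/

namespace HomBundle

open scoped ComplexConjugate

/-! ### Wirtinger calculus for scalar and matrix-valued functions. -/

/-- `f` is real differentiable at `z`, with Wirtinger derivatives `∂f = p` and `∂̄f = q`. -/
def HasWirtingerAt (f : ℂ → ℂ) (p q z : ℂ) : Prop :=
  HasFDerivAt f (p • (1 : ℂ →L[ℝ] ℂ) + q • (Complex.conjCLE : ℂ →L[ℝ] ℂ)) z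

namespace HasWirtingerAt

variable {f g : ℂ → ℂ} {p q p' q' z : ℂ}

theorem const (c : ℂ) : HasWirtingerAt (fun _ => c) 0 0 z := by
  refine (hasFDerivAt_const (𝕜 := ℝ) c z).congr_fderiv ?_
  ext; simp

theorem id : HasWirtingerAt (fun w => w) 1 0 z := by
  refine (hasFDerivAt_id (𝕜 := ℝ) z).congr_fderiv ?_
  ext; simp

theorem star (hf : HasWirtingerAt f p q z) :
    HasWirtingerAt (fun w => conj (f w)) (conj q) (conj p) z := by
  refine ((Complex.conjCLE : ℂ →L[ℝ] ℂ).hasFDerivAt.comp z hf).congr_fderiv ?_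
  ext; simp [add_comm]

theorem add (hf : HasWirtingerAt f p q z) (hg : HasWirtingerAt g p' q' z) :
    HasWirtingerAt (fun w => f w + g w) (p + p') (q + q') z := by
  refine (HasFDerivAt.add hf hg).congr_fderiv ?_
  ext v
  simp
  ring

theorem mul (hf : HasWirtingerAt f p q z) (hg : HasWirtingerAt g p' q' z) :
    HasWirtingerAt (fun w => f w * g w) (p * g z + f z * p') (q * g z + f z * q') z := by
  refine (HasFDerivAt.mul hf hg).congr_fderiv ?_
  ext v
  simp
  ring

theorem sum {α : Type*} (t : Finset α) {F : α → ℂ → ℂ} {P Q : α → ℂ}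
    (h : ∀ a, HasWirtingerAt (F a) (P a) (Q a) z) :
    HasWirtingerAt (fun w => ∑ a ∈ t, F a w) (∑ a ∈ t, P a) (∑ a ∈ t, Q a) z := by
  refine (HasFDerivAt.fun_sum fun a _ => h a).congr_fderiv ?_
  ext v
  simp [Finset.sum_add_distrib, Finset.sum_mul]

theorem _root_.HasDerivAt.comp_hasWirtingerAt {k : ℂ → ℂ} {k' : ℂ} (hk : HasDerivAt k k' (f z))
    (hf : HasWirtingerAt f p q z) :
    HasWirtingerAt (fun w => k (f w)) (k' * p) (k' * q) z := by
  refine ((hk.hasFDerivAt.restrictScalars ℝ).comp z hf).congr_fderiv ?_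
  ext v
  simp
  ring

theorem unique (h : HasWirtingerAt f p q z) (h' : HasWirtingerAt f p' q' z) :
    p = p' ∧ q = q' := by
  have e := HasFDerivAt.unique h h'
  -- A real-linear map `v ↦ p v + q v̄` is determined by its values `p + q` at `1` and `i (p - q)`
  -- at `i`.
  have e1 := DFunLike.congr_fun e 1
  have e2 := DFunLike.congr_fun e Complex.I
  simp at e1 e2
  have e3 : p - q = p' - q' := by
    apply mul_right_cancel₀ Complex.I_ne_zero
    linear_combination e2
  exact ⟨by linear_combination (e1 + e3) / 2, by linear_combination (e1 - e3) / 2⟩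

theorem congr_of_eventuallyEq (h : HasWirtingerAt f p q z) (hg : g =ᶠ[nhds z] f) :
    HasWirtingerAt g p q z :=
  HasFDerivAt.congr_of_eventuallyEq h hg

/-- Mixed Wirtinger derivatives commute. -/
theorem mixed_eq {P Q : ℂ → ℂ} {p₁ p₂ q₁ q₂ : ℂ}
    (hf : ∀ᶠ w in nhds z, HasWirtingerAt f (P w) (Q w) w)
    (hP : HasWirtingerAt P p₁ p₂ z) (hQ : HasWirtingerAt Q q₁ q₂ z) : p₂ = q₁ := by
  have hd : HasFDerivAt (fun w => P w • (1 : ℂ →L[ℝ] ℂ) + Q w • (Complex.conjCLE : ℂ →L[ℝ] ℂ))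
      _ z := (HasFDerivAt.smul_const hP (1 : ℂ →L[ℝ] ℂ)).add
        (HasFDerivAt.smul_const hQ (Complex.conjCLE : ℂ →L[ℝ] ℂ))
  -- On the pair `(1, i)` the pure second derivatives `p₁` and `q₂` cancel, and the asymmetry is `2i
  -- (p₂ - q₁)`.
  have := second_derivative_symmetric_of_eventually hf hd 1 Complex.I
  simp at this
  have h2 : (2 * Complex.I) * (p₂ - q₁) = 0 := by linear_combination this
  simpa [sub_eq_zero] using h2

end HasWirtingerAt

/-- Entrywise Wirtinger derivatives `∂f = P` and `∂̄f = Q` of a matrix-valued function. -/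
def MatrixHasWirtingerAt {κ ι : Type*} (f : ℂ → Matrix κ ι ℂ) (P Q : Matrix κ ι ℂ) (z : ℂ) :
    Prop :=
  ∀ i j, HasWirtingerAt (fun w => f w i j) (P i j) (Q i j) z

namespace MatrixHasWirtingerAt

variable {ι κ ν : Type*} {f g : ℂ → Matrix κ ι ℂ} {P Q P' Q' : Matrix κ ι ℂ} {z : ℂ}

theorem const (A : Matrix κ ι ℂ) : MatrixHasWirtingerAt (fun _ => A) 0 0 z :=
  fun i j => .const (A i j)

theorem add (hf : MatrixHasWirtingerAt f P Q z) (hg : MatrixHasWirtingerAt g P' Q' z) :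
    MatrixHasWirtingerAt (fun w => f w + g w) (P + P') (Q + Q') z :=
  fun i j => (hf i j).add (hg i j)

theorem smul {s : ℂ → ℂ} {p q : ℂ} (hs : HasWirtingerAt s p q z)
    (hf : MatrixHasWirtingerAt f P Q z) :
    MatrixHasWirtingerAt (fun w => s w • f w) (p • f z + s z • P) (q • f z + s z • Q) z :=
  fun i j => hs.mul (hf i j)

theorem mul [Fintype ι] {k : ℂ → Matrix ι ν ℂ} {R S : Matrix ι ν ℂ}
    (hf : MatrixHasWirtingerAt f P Q z) (hk : MatrixHasWirtingerAt k R S z) :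
    MatrixHasWirtingerAt (fun w => f w * k w) (P * k z + f z * R) (Q * k z + f z * S) z := by
  intro i j
  have := HasWirtingerAt.sum Finset.univ fun a => (hf i a).mul (hk a j)
  simpa only [Matrix.mul_apply, Matrix.add_apply, Finset.sum_add_distrib] using this

theorem const_mul [Fintype κ] (A : Matrix ν κ ℂ) (hf : MatrixHasWirtingerAt f P Q z) :
    MatrixHasWirtingerAt (fun w => A * f w) (A * P) (A * Q) z := by
  simpa using (const A).mul hf

theorem mul_const [Fintype ι] (hf : MatrixHasWirtingerAt f P Q z) (A : Matrix ι ν ℂ) :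
    MatrixHasWirtingerAt (fun w => f w * A) (P * A) (Q * A) z := by
  simpa using hf.mul (const A)

theorem neg (hf : MatrixHasWirtingerAt f P Q z) :
    MatrixHasWirtingerAt (fun w => - f w) (-P) (-Q) z := by
  simpa using hf.smul (.const (-1))

theorem sub (hf : MatrixHasWirtingerAt f P Q z) (hg : MatrixHasWirtingerAt g P' Q' z) :
    MatrixHasWirtingerAt (fun w => f w - g w) (P - P') (Q - Q') z := by
  simpa only [sub_eq_add_neg] using hf.add hg.neg

theorem conjTranspose (hf : MatrixHasWirtingerAt f P Q z) :
    MatrixHasWirtingerAt (fun w => (f w).conjTranspose) Q.conjTranspose P.conjTranspose z :=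
  fun i j => (hf j i).star

theorem unique (h : MatrixHasWirtingerAt f P Q z) (h' : MatrixHasWirtingerAt f P' Q' z) :
    P = P' ∧ Q = Q' :=
  ⟨by ext i j; exact ((h i j).unique (h' i j)).1, by ext i j; exact ((h i j).unique (h' i j)).2⟩

theorem congr_right (h : MatrixHasWirtingerAt f P Q z) (hQ : Q' = Q) :
    MatrixHasWirtingerAt f P Q' z :=
  hQ ▸ h

theorem congr_of_eventuallyEq (h : MatrixHasWirtingerAt f P Q z) (hg : g =ᶠ[nhds z] f) :
    MatrixHasWirtingerAt g P Q z :=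
  fun i j => (h i j).congr_of_eventuallyEq (hg.mono fun w hw => by simp only [hw])

theorem mixed_eq {P Q : ℂ → Matrix κ ι ℂ} {P₁ P₂ Q₁ Q₂ : Matrix κ ι ℂ}
    (hf : ∀ᶠ w in nhds z, MatrixHasWirtingerAt f (P w) (Q w) w)
    (hP : MatrixHasWirtingerAt P P₁ P₂ z) (hQ : MatrixHasWirtingerAt Q Q₁ Q₂ z) : P₂ = Q₁ := by
  ext i j
  exact HasWirtingerAt.mixed_eq (hf.mono fun w hw => hw i j) (hP i j) (hQ i j)

end MatrixHasWirtingerAt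

end HomBundle

/-! ### The differential system of an isometry, its curvature and derived intertwining relations. -/

namespace HomBundle

open scoped ComplexConjugate

theorem one_sub_mul_conj_ne_zero {z : ℂ} (hz : z ∈ Metric.ball (0 : ℂ) 1) :
    1 - z * conj z ≠ 0 := by
  rw [Complex.mul_conj, Complex.normSq_eq_norm_sq]
  have := mem_ball_zero_iff.1 hz
  have h : 1 - ‖z‖ ^ 2 ≠ 0 := by nlinarith [norm_nonneg z]
  exact_mod_cast h

theorem hasWirtingerAt_one_sub_mul_conj (z : ℂ) :
    HasWirtingerAt (fun w => 1 - w * conj w) (-conj z) (-z) z := by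
  have h := (HasWirtingerAt.const (z := z) 1).add
    ((HasWirtingerAt.const (-1)).mul (HasWirtingerAt.id.mul HasWirtingerAt.id.star))
  simpa [sub_eq_add_neg] using h

theorem hasWirtingerAt_inv_one_sub_mul_conj {z : ℂ} (hz : z ∈ Metric.ball (0 : ℂ) 1) :
    HasWirtingerAt (fun w => (1 - w * conj w)⁻¹) (conj z * (1 - z * conj z)⁻¹ ^ 2)
      (z * (1 - z * conj z)⁻¹ ^ 2) z := by
  have h0 := one_sub_mul_conj_ne_zero hz
  have h := HasDerivAt.comp_hasWirtingerAt (f := fun w => 1 - w * conj w) (hasDerivAt_inv h0)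
    (hasWirtingerAt_one_sub_mul_conj z)
  convert h using 1 <;> field_simp

theorem matrixHasWirtingerAt_add_smul {κ ι : Type*} (Y M : Matrix κ ι ℂ) (z : ℂ) :
    MatrixHasWirtingerAt (fun w => Y + w • M) M 0 z := by
  simpa using (MatrixHasWirtingerAt.const Y).add
    (MatrixHasWirtingerAt.smul .id (MatrixHasWirtingerAt.const M))

theorem matrixHasWirtingerAt_add_conj_smul {κ ι : Type*} (Y M : Matrix κ ι ℂ) (z : ℂ) :
    MatrixHasWirtingerAt (fun w => Y + conj w • M) 0 M z := by
  simpa using (MatrixHasWirtingerAt.const Y).add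
    (MatrixHasWirtingerAt.smul HasWirtingerAt.id.star (MatrixHasWirtingerAt.const M))

section Transport

variable {ι κ : Type*} [Fintype ι] [Fintype κ]

/-- `φ` solves the system that expresses that it is a holomorphic isometry between the bundles
over the disc with data `(M, Y, W)` and `(M', Y', W')`, in frames in which the metrics are
constant; here `W` is the adjoint of `Y`. -/
def IsParallel (M Y W : Matrix ι ι ℂ) (M' Y' W' : Matrix κ κ ℂ) (φ : ℂ → Matrix κ ι ℂ) : Prop :=
  ∀ z ∈ Metric.ball (0 : ℂ) 1, MatrixHasWirtingerAt φ
    ((1 - z * conj z)⁻¹ • ((W' + conj z • M') * φ z - φ z * (W + conj z • M)))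
    ((1 - z * conj z)⁻¹ • (φ z * (Y + z • M) - (Y' + z • M') * φ z)) z

theorem eventually_mem_ball {z : ℂ} (hz : z ∈ Metric.ball (0 : ℂ) 1) :
    ∀ᶠ w in nhds z, w ∈ Metric.ball (0 : ℂ) 1 :=
  Metric.isOpen_ball.mem_nhds hz

variable {M Y W : Matrix ι ι ℂ} {M' Y' W' : Matrix κ κ ℂ} {φ : ℂ → Matrix κ ι ℂ}

/-- A solution intertwines the curvatures. -/
theorem IsParallel.curvature (hφ : IsParallel M Y W M' Y' W' φ)
    (hY : M * Y - Y * M = Y) (hW : M * W - W * M = -W)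
    (hY' : M' * Y' - Y' * M' = Y') (hW' : M' * W' - W' * M' = -W')
    {z : ℂ} (hz : z ∈ Metric.ball (0 : ℂ) 1) :
    (2 • M' + (Y' * W' - W' * Y')) * φ z = φ z * (2 • M + (Y * W - W * Y)) := by
  have hs := hasWirtingerAt_inv_one_sub_mul_conj hz
  have hP := MatrixHasWirtingerAt.smul hs
    (((matrixHasWirtingerAt_add_conj_smul W' M' z).mul (hφ z hz)).sub
      ((hφ z hz).mul (matrixHasWirtingerAt_add_conj_smul W M z)))
  have hQ := MatrixHasWirtingerAt.smul hs
    (((hφ z hz).mul (matrixHasWirtingerAt_add_smul Y M z)).sub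
      ((matrixHasWirtingerAt_add_smul Y' M' z).mul (hφ z hz)))
  -- The curvature relation is the integrability condition `∂̄∂φ = ∂∂̄φ` of the system.
  have key := MatrixHasWirtingerAt.mixed_eq ((eventually_mem_ball hz).mono hφ) hP hQ
  have h0 := one_sub_mul_conj_ne_zero hz
  generalize φ z = u at key ⊢
  generalize hc : conj z = c at key h0
  have ht : (1 - z * c)⁻¹ * (1 - z * c) = 1 := inv_mul_cancel₀ h0
  generalize (1 - z * c)⁻¹ = t at key ht
  -- The weight relations bring all products to one normal order of `M` against `Y` and `W`, so that
  -- only scalar coefficients remain to be compared.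
  have e1 : u * (M * Y) = u * (Y * M) + u * Y := by
    rw [← Matrix.mul_add, ← sub_eq_iff_eq_add'.1 hY]
  have e2 : u * (M * W) = u * (W * M) - u * W := by
    rw [← Matrix.mul_sub, sub_eq_add_neg, ← sub_eq_iff_eq_add'.1 hW]
  have e3 : M' * (Y' * u) = Y' * (M' * u) + Y' * u := by
    simp only [← Matrix.mul_assoc]
    rw [← Matrix.add_mul, ← sub_eq_iff_eq_add'.1 hY']
  have e4 : M' * (W' * u) = W' * (M' * u) - W' * u := by
    simp only [← Matrix.mul_assoc]
    rw [← Matrix.sub_mul, sub_eq_add_neg, ← sub_eq_iff_eq_add'.1 hW']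
  -- The scalar identities hold modulo `t (1 - z z̄) = 1`, and the nonzero factor `t²` can be
  -- cancelled.
  have key2 : t ^ 2 • ((2 • M' + (Y' * W' - W' * Y')) * u -
      u * (2 • M + (Y * W - W * Y))) = 0 := by
    simp only [Matrix.mul_add, Matrix.add_mul, Matrix.mul_sub, Matrix.sub_mul, Matrix.smul_mul,
      Matrix.mul_smul, Matrix.mul_assoc, smul_add, smul_sub, smul_smul,
      two_smul, e1, e2, e3, e4] at key ⊢
    linear_combination (norm := skip) key
    match_scalars
    all_goals first
      | ring1
      | linear_combination (t * 2) * ht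
      | linear_combination (-t * 2) * ht
  have : t ≠ 0 := left_ne_zero_of_mul_eq_one ht
  exact sub_eq_zero.1 ((smul_eq_zero.1 key2).resolve_left (pow_ne_zero 2 this))

/-- Differentiating an intertwining relation gives intertwining relations for the commutators. -/
theorem IsParallel.commutator (hφ : IsParallel M Y W M' Y' W' φ)
    {w : Matrix ι ι ℂ} {w' : Matrix κ κ ℂ} {δ : ℂ}
    (hw : M * w - w * M = δ • w) (hw' : M' * w' - w' * M' = δ • w')
    (h : ∀ z ∈ Metric.ball (0 : ℂ) 1, w' * φ z = φ z * w)
    {z : ℂ} (hz : z ∈ Metric.ball (0 : ℂ) 1) :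
    (Y' * w' - w' * Y') * φ z = φ z * (Y * w - w * Y) ∧
      (W' * w' - w' * W') * φ z = φ z * (W * w - w * W) := by
  -- Both sides of `w' φ = φ w` are differentiated; equal functions have equal Wirtinger
  -- derivatives, and the scalar `(1 - z z̄)⁻¹` cancels.
  have h1 := (hφ z hz).const_mul w'
  have h2 := ((hφ z hz).mul_const w).congr_of_eventuallyEq ((eventually_mem_ball hz).mono h)
  have hs := inv_ne_zero (one_sub_mul_conj_ne_zero hz)
  obtain ⟨hP, hQ⟩ := h1.unique h2
  have hz' := h z hz
  rw [Matrix.mul_smul, Matrix.smul_mul] at hP hQ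
  have hP := smul_right_injective _ hs hP
  have hQ := smul_right_injective _ hs hQ
  generalize φ z = u at *
  have f1 : M' * (w' * u) = w' * (M' * u) + δ • (w' * u) := by
    rw [← Matrix.mul_assoc, ← Matrix.mul_assoc, ← Matrix.smul_mul, ← Matrix.add_mul,
      ← sub_eq_iff_eq_add'.1 hw']
  have f2 : u * (M * w) = u * (w * M) + δ • (u * w) := by
    rw [← Matrix.mul_smul, ← Matrix.mul_add, ← sub_eq_iff_eq_add'.1 hw]
  have f3 : ∀ A : Matrix ι ι ℂ, w' * (u * A) = u * (w * A) := fun A => by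
    rw [← Matrix.mul_assoc, hz', Matrix.mul_assoc]
  -- The derivatives say that `φ` intertwines the commutators of `Y + zM` and of `W + z̄M` with `w`.
  -- By pure weight the `M` parts are multiples of `w' φ = φ w`, with the same `δ` on both sides,
  -- and drop out.
  constructor
  · simp only [Matrix.mul_add, Matrix.add_mul, Matrix.mul_sub, Matrix.sub_mul, Matrix.smul_mul,
      Matrix.mul_smul, Matrix.mul_assoc, ← hz', f2, f3] at hQ f1 ⊢
    linear_combination (norm := module) hQ - z • f1
  · simp only [Matrix.mul_add, Matrix.add_mul, Matrix.mul_sub, Matrix.sub_mul, Matrix.smul_mul,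
      Matrix.mul_smul, Matrix.mul_assoc, ← hz', f2, f3] at hP f1 ⊢
    linear_combination (norm := module) -hP - (conj z) • f1

end Transport

end HomBundle

/-! ### Triviality of finite-dimensional unitary representations of `𝔰𝔲(1,1)`, applied to
intertwiners. -/

namespace HomBundle

open scoped InnerProductSpace

/-- Finite-dimensional unitary representations of `𝔰𝔲(1,1)` are trivial. -/
theorem eq_zero_of_su11_relations {V : Type*} [AddCommGroup V] [Module ℂ V]
    [FiniteDimensional ℂ V] (c : InnerProductSpace.Core ℂ V) (y w m : V →ₗ[ℂ] V)
    (hyw : ∀ a b, c.inner (y a) b = c.inner a (w b))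
    (hm : ∀ a b, c.inner (m a) b = c.inner a (m b))
    (hmy : m * y - y * m = y) (h2m : 2 • m = w * y - y * w) : y = 0 ∧ m = 0 := by
  let : NormedAddCommGroup V := c.toNormedAddCommGroup
  let : InnerProductSpace ℂ V := InnerProductSpace.ofCore c.toCore
  have hyw' : ∀ a b, ⟪y a, b⟫_ℂ = ⟪a, w b⟫_ℂ := hyw
  have hm' : ∀ a b, ⟪m a, b⟫_ℂ = ⟪a, m b⟫_ℂ := hm
  let b := stdOrthonormalBasis ℂ V
  have t1 : LinearMap.trace ℂ V (m * m) = ((∑ i, ‖m (b i)‖ ^ 2 : ℝ) : ℂ) := by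
    rw [LinearMap.trace_eq_sum_inner _ b]
    push_cast
    refine Finset.sum_congr rfl fun i _ => ?_
    rw [Module.End.mul_apply, ← hm']
    exact inner_self_eq_norm_sq_to_K _
  have t2 : LinearMap.trace ℂ V (w * y) = ((∑ i, ‖y (b i)‖ ^ 2 : ℝ) : ℂ) := by
    rw [LinearMap.trace_eq_sum_inner _ b]
    push_cast
    refine Finset.sum_congr rfl fun i _ => ?_
    rw [Module.End.mul_apply, ← hyw']
    exact inner_self_eq_norm_sq_to_K _
  -- By cyclicity `2 tr(m²) = tr([w, y] m) = tr(w [y, m]) = -tr(w y)`. Both traces are sums of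
  -- squares because `m` is self-adjoint and `w` is the adjoint of `y`, so both vanish.
  have t3 : 2 * LinearMap.trace ℂ V (m * m) + LinearMap.trace ℂ V (w * y) = 0 := by
    have e1 : 2 * LinearMap.trace ℂ V (m * m) = LinearMap.trace ℂ V ((w * y - y * w) * m) := by
      rw [← h2m, two_nsmul, add_mul, map_add, two_mul]
    have e2 : LinearMap.trace ℂ V (y * w * m) = LinearMap.trace ℂ V (w * m * y) := by
      rw [mul_assoc, LinearMap.trace_mul_comm]
    have e3 : LinearMap.trace ℂ V (w * y) =
        LinearMap.trace ℂ V (w * m * y) - LinearMap.trace ℂ V (w * y * m) := by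
      conv_lhs => rw [← hmy, mul_sub, map_sub, ← mul_assoc, ← mul_assoc]
    rw [e1, sub_mul, map_sub, e2, e3]
    ring
  rw [t1, t2] at t3
  have t4 : 2 * (∑ i, ‖m (b i)‖ ^ 2) + ∑ i, ‖y (b i)‖ ^ 2 = 0 := by exact_mod_cast t3
  have n1 : 0 ≤ ∑ i, ‖m (b i)‖ ^ 2 := Finset.sum_nonneg fun i _ => sq_nonneg _
  have n2 : 0 ≤ ∑ i, ‖y (b i)‖ ^ 2 := Finset.sum_nonneg fun i _ => sq_nonneg _
  have z1 : ∑ i, ‖m (b i)‖ ^ 2 = 0 := by linarith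
  have z2 : ∑ i, ‖y (b i)‖ ^ 2 = 0 := by linarith
  rw [Finset.sum_eq_zero_iff_of_nonneg fun i _ => sq_nonneg _] at z1 z2
  constructor
  · exact b.toBasis.ext fun i => by simpa using z2 i (Finset.mem_univ i)
  · exact b.toBasis.ext fun i => by simpa using z1 i (Finset.mem_univ i)

variable {ι κ : Type*} [Fintype ι] [Fintype κ]

/-- The inner product `tr((S C R)ᴴ (S D R))` on a space of matrices. -/
@[reducible]
def traceCore [DecidableEq ι] [DecidableEq κ] (𝒦 : Submodule ℂ (Matrix κ ι ℂ)) (S : Matrix κ κ ℂ)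
    (R : Matrix ι ι ℂ) (hS : IsUnit S) (hR : IsUnit R) : InnerProductSpace.Core ℂ 𝒦 where
  inner C D := ((S * C.1 * R).conjTranspose * (S * D.1 * R)).trace
  conj_inner_symm C D := by
    rw [starRingEnd_apply, ← Matrix.trace_conjTranspose, Matrix.conjTranspose_mul,
      Matrix.conjTranspose_conjTranspose]
  re_inner_nonneg C :=
    (Complex.nonneg_iff.1 (Matrix.posSemidef_conjTranspose_mul_self (S * C.1 * R)).trace_nonneg).1
  add_left C D E := by
    simp [Matrix.mul_add, Matrix.add_mul]
  smul_left C D r := by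
    simp
  definite C hC := by
    have h := Matrix.trace_conjTranspose_mul_self_eq_zero_iff.1 hC
    obtain ⟨⟨S, S', _, hS'⟩, rfl⟩ := hS
    obtain ⟨⟨R, R', hR', _⟩, rfl⟩ := hR
    have h' := congrArg (fun X => S' * X * R') h
    simp only [Matrix.mul_assoc, hR', Matrix.mul_one, Matrix.mul_zero, Matrix.zero_mul] at h'
    rw [← Matrix.mul_assoc, hS', Matrix.one_mul] at h'
    exact Subtype.ext h'

theorem _root_.Matrix.PosDef.exists_isUnit_eq_conjTranspose_mul_self [DecidableEq ι]
    {H : Matrix ι ι ℂ} (hH : H.PosDef) :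
    ∃ S : Matrix ι ι ℂ, IsUnit S ∧ H = S.conjTranspose * S := by
  open scoped MatrixOrder in
  obtain ⟨S, hS⟩ := CStarAlgebra.nonneg_iff_eq_star_mul_self.1 hH.posSemidef.nonneg
  exact ⟨S, isUnit_of_mul_isUnit_right (hS ▸ hH.isUnit), hS⟩

/-- A space of matrices that is stable under `C ↦ Y' C - C Y`, its adjoint and `C ↦ M' C - C M`
and that intertwines the curvatures consists of matrices that intertwine `Y` and `Y'`, and `M`
and `M'`. -/
theorem intertwines_of_stable [DecidableEq ι] [DecidableEq κ] {M Y W H : Matrix ι ι ℂ}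
    {M' Y' W' H' : Matrix κ κ ℂ} (hH : H.PosDef) (hH' : H'.PosDef)
    (hHW : H * W = Y.conjTranspose * H) (hHW' : H' * W' = Y'.conjTranspose * H')
    (hHM : H * M = M.conjTranspose * H) (hHM' : H' * M' = M'.conjTranspose * H')
    (hY : M * Y - Y * M = Y) (hY' : M' * Y' - Y' * M' = Y')
    (𝒦 : Submodule ℂ (Matrix κ ι ℂ)) (h𝒦Y : ∀ C ∈ 𝒦, Y' * C - C * Y ∈ 𝒦)
    (h𝒦W : ∀ C ∈ 𝒦, W' * C - C * W ∈ 𝒦) (h𝒦M : ∀ C ∈ 𝒦, M' * C - C * M ∈ 𝒦)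
    (hcurv : ∀ C ∈ 𝒦, (2 • M' + (Y' * W' - W' * Y')) * C = C * (2 • M + (Y * W - W * Y)))
    {C : Matrix κ ι ℂ} (hC : C ∈ 𝒦) : Y' * C = C * Y ∧ M' * C = C * M := by
  obtain ⟨S, hS, rfl⟩ := hH.exists_isUnit_eq_conjTranspose_mul_self
  obtain ⟨S', hS', rfl⟩ := hH'.exists_isUnit_eq_conjTranspose_mul_self
  obtain ⟨⟨S, R, hSR, hRS⟩, rfl⟩ := hS
  simp only at hHW hHM
  have hR : IsUnit R := ⟨⟨R, S, hRS, hSR⟩, rfl⟩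
  have hRS' : R.conjTranspose * S.conjTranspose = 1 := by
    rw [← Matrix.conjTranspose_mul, hSR, Matrix.conjTranspose_one]
  have hSR' : S.conjTranspose * R.conjTranspose = 1 := by
    rw [← Matrix.conjTranspose_mul, hRS, Matrix.conjTranspose_one]
  let L (A : Matrix ι ι ℂ) (A' : Matrix κ κ ℂ) (h : ∀ C ∈ 𝒦, A' * C - C * A ∈ 𝒦) :
      𝒦 →ₗ[ℂ] 𝒦 :=
    { toFun := fun C => ⟨A' * C.1 - C.1 * A, h C.1 C.2⟩
      map_add' := fun C D => Subtype.ext (by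
        simp only [Submodule.coe_add, Matrix.mul_add, Matrix.add_mul]
        abel)
      map_smul' := fun r C => Subtype.ext (by
        simp [smul_sub]) }
  -- With `R = S⁻¹` the form of `traceCore` is the Hilbert–Schmidt product for the metrics `Sᴴ S`
  -- and `S'ᴴ S'`. Hence the adjoint of `C ↦ A'C - CA` is `C ↦ B'C - CB`, where `B` and `B'` are the
  -- metric adjoints of `A` and `A'`.
  have hL : ∀ A A' B B' hA hB,
      S.conjTranspose * S * B = A.conjTranspose * (S.conjTranspose * S) →
      S'.conjTranspose * S' * B' = A'.conjTranspose * (S'.conjTranspose * S') →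
      ∀ C D, (traceCore 𝒦 S' R hS' hR).inner (L A A' hA C) D =
        (traceCore 𝒦 S' R hS' hR).inner C (L B B' hB D) := by
    intro A A' B B' hA hB h h' C D
    have e : R.conjTranspose * A.conjTranspose = S * B * R * R.conjTranspose := by
      have := congrArg (fun X => R.conjTranspose * X * R * R.conjTranspose) h
      simp only [Matrix.mul_assoc] at this
      rw [← Matrix.mul_assoc S R, hSR, Matrix.one_mul, hSR', Matrix.mul_one,
        ← Matrix.mul_assoc _ _ (S * _), hRS', Matrix.one_mul] at this
      simp only [Matrix.mul_assoc, this]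
    show ((S' * (A' * C.1 - C.1 * A) * R).conjTranspose * (S' * D.1 * R)).trace =
      ((S' * C.1 * R).conjTranspose * (S' * (B' * D.1 - D.1 * B) * R)).trace
    simp only [Matrix.mul_sub, Matrix.sub_mul, Matrix.conjTranspose_sub, Matrix.conjTranspose_mul,
      Matrix.trace_sub]
    congr 1
    · congr 1
      have := congrArg (fun X => R.conjTranspose * C.1.conjTranspose * X * D.1 * R) h'
      simp only [Matrix.mul_assoc] at this ⊢
      exact this.symm
    · have := congrArg (fun X => X * (C.1.conjTranspose * S'.conjTranspose * S' * D.1) * R) e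
      simp only [Matrix.mul_assoc] at this ⊢
      rw [this]
      simp only [← Matrix.mul_assoc]
      rw [Matrix.trace_mul_comm _ R]
      simp only [← Matrix.mul_assoc]
      rw [hRS, Matrix.one_mul]
      simp only [Matrix.mul_assoc]
      rw [Matrix.trace_mul_comm B]
      simp only [Matrix.mul_assoc]
      rw [← Matrix.mul_assoc R, Matrix.trace_mul_comm]
      simp only [Matrix.mul_assoc]
      conv_rhs => rw [Matrix.trace_mul_comm]
      simp only [Matrix.mul_assoc]
  -- Of the two relations left to check, `[m, y] = y` comes from the weights of `Y` and `Y'`, and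
  -- `2m = [w, y]` is the curvature relation `hcurv`; its sign is that of the noncompact form.
  have hz := eq_zero_of_su11_relations (traceCore 𝒦 S' R hS' hR) (L Y Y' h𝒦Y) (L W W' h𝒦W)
    (L M M' h𝒦M) (hL _ _ _ _ _ _ hHW hHW') (hL _ _ _ _ _ _ hHM hHM') ?_ ?_
  · exact ⟨sub_eq_zero.1 (congrArg Subtype.val (LinearMap.congr_fun hz.1 ⟨C, hC⟩)),
      sub_eq_zero.1 (congrArg Subtype.val (LinearMap.congr_fun hz.2 ⟨C, hC⟩))⟩
  · ext1 C
    apply Subtype.ext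
    show M' * (Y' * C.1 - C.1 * Y) - (Y' * C.1 - C.1 * Y) * M -
      (Y' * (M' * C.1 - C.1 * M) - (M' * C.1 - C.1 * M) * Y) = Y' * C.1 - C.1 * Y
    have e1 := congrArg (fun X => C.1 * X) hY
    have e2 := congrArg (fun X => X * C.1) hY'
    simp only [Matrix.mul_sub, Matrix.sub_mul, Matrix.mul_assoc] at e1 e2 ⊢
    linear_combination (norm := module) e2 - e1
  · ext1 C
    apply Subtype.ext
    show 2 • (M' * C.1 - C.1 * M) = W' * (Y' * C.1 - C.1 * Y) - (Y' * C.1 - C.1 * Y) * W -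
      (Y' * (W' * C.1 - C.1 * W) - (W' * C.1 - C.1 * W) * Y)
    have e := hcurv C.1 C.2
    simp only [Matrix.mul_sub, Matrix.sub_mul, Matrix.mul_add, Matrix.add_mul, Matrix.smul_mul,
      Matrix.mul_smul, Matrix.mul_assoc] at e ⊢
    linear_combination (norm := module) e

/-! ### The space cut out by all intertwining relations of a parallel isometry. -/

section Transport

variable {M Y W H : Matrix ι ι ℂ} {M' Y' W' H' : Matrix κ κ ℂ} {φ : ℂ → Matrix κ ι ℂ}

/-- The matrices of pure weight that are intertwined by `φ`. -/
def IsIntertwinedPair (M : Matrix ι ι ℂ) (M' : Matrix κ κ ℂ) (φ : ℂ → Matrix κ ι ℂ)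
    (w' : Matrix κ κ ℂ) (w : Matrix ι ι ℂ) : Prop :=
  (∃ δ : ℂ, M * w - w * M = δ • w ∧ M' * w' - w' * M' = δ • w') ∧
    ∀ z ∈ Metric.ball (0 : ℂ) 1, w' * φ z = φ z * w

/-- If `A` shifts weights by `ε` then so does `[A, ·]`. -/
theorem weight_commutator {M A w : Matrix ι ι ℂ} {ε δ : ℂ} (hA : M * A - A * M = ε • A)
    (hw : M * w - w * M = δ • w) :
    M * (A * w - w * A) - (A * w - w * A) * M = (δ + ε) • (A * w - w * A) := by
  have e1 := congrArg (fun X => X * w) hA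
  have e2 := congrArg (fun X => w * X) hA
  have e3 := congrArg (fun X => X * A) hw
  have e4 := congrArg (fun X => A * X) hw
  simp only [Matrix.mul_sub, Matrix.sub_mul, Matrix.smul_mul, Matrix.mul_smul, Matrix.mul_assoc]
    at e1 e2 e3 e4 ⊢
  linear_combination (norm := module) e1 - e2 - e3 + e4

/-- `Y` has weight `1` and `W` weight `-1`, so `[Y, W]` has weight `0`, as has `M`. This lets the
curvatures serve as an intertwined pair of pure weight. -/
theorem weight_curvature {M Y W : Matrix ι ι ℂ} (hY : M * Y - Y * M = Y)
    (hW : M * W - W * M = -W) :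
    M * (2 • M + (Y * W - W * Y)) - (2 • M + (Y * W - W * Y)) * M =
      (0 : ℂ) • (2 • M + (Y * W - W * Y)) := by
  have h := weight_commutator (M := M) (A := Y) (w := W) (ε := 1) (δ := -1) (by rw [one_smul, hY])
    (by rw [neg_smul, one_smul, hW])
  rw [neg_add_cancel, zero_smul] at h
  rw [zero_smul, ← h, Matrix.mul_add, Matrix.add_mul, Matrix.mul_smul, Matrix.smul_mul]
  abel

/-- If `w' C = C w` and `[A', w'] C = C [A, w]` then `A' C - C A` intertwines `w` and `w'`. -/
theorem intertwines_sub {A w : Matrix ι ι ℂ} {A' w' : Matrix κ κ ℂ} {C : Matrix κ ι ℂ}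
    (h1 : w' * C = C * w) (h2 : (A' * w' - w' * A') * C = C * (A * w - w * A)) :
    w' * (A' * C - C * A) = (A' * C - C * A) * w := by
  have e1 := congrArg (fun X => A' * X) h1
  have e2 := congrArg (fun X => X * A) h1
  simp only [Matrix.mul_sub, Matrix.sub_mul, Matrix.mul_assoc] at e1 e2 h2 ⊢
  linear_combination (norm := module) e1 - e2 - h2

/-- A parallel isometry intertwines `Y` and `Y'`, and `M` and `M'`. -/
theorem IsParallel.intertwines [DecidableEq ι] [DecidableEq κ]
    (hφ : IsParallel M Y W M' Y' W' φ) (hH : H.PosDef) (hH' : H'.PosDef)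
    (hHW : H * W = Y.conjTranspose * H) (hHW' : H' * W' = Y'.conjTranspose * H')
    (hHM : H * M = M.conjTranspose * H) (hHM' : H' * M' = M'.conjTranspose * H')
    (hY : M * Y - Y * M = Y) (hW : M * W - W * M = -W)
    (hY' : M' * Y' - Y' * M' = Y') (hW' : M' * W' - W' * M' = -W') :
    Y' * φ 0 = φ 0 * Y ∧ M' * φ 0 = φ 0 * M := by
  have comm : ∀ w' w, IsIntertwinedPair M M' φ w' w →
      IsIntertwinedPair M M' φ (Y' * w' - w' * Y') (Y * w - w * Y) ∧
      IsIntertwinedPair M M' φ (W' * w' - w' * W') (W * w - w * W) := by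
    rintro w' w ⟨⟨δ, h1, h2⟩, h3⟩
    refine ⟨⟨⟨δ + 1, ?_, ?_⟩, fun z hz => (hφ.commutator h1 h2 h3 hz).1⟩,
      ⟨⟨δ + -1, ?_, ?_⟩, fun z hz => (hφ.commutator h1 h2 h3 hz).2⟩⟩
    · exact weight_commutator (by rw [one_smul, hY]) h1
    · exact weight_commutator (by rw [one_smul, hY']) h2
    · exact weight_commutator (by rw [neg_smul, one_smul, hW]) h1
    · exact weight_commutator (by rw [neg_smul, one_smul, hW']) h2
  -- The images of `φ 0` under the three operators need not be multiples of it, so a stable space is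
  -- needed. Stability under `Y` and `W` follows from `comm`, and stability under `M` from pure
  -- weight.
  let 𝒦 : Submodule ℂ (Matrix κ ι ℂ) :=
    { carrier := {C | ∀ w' w, IsIntertwinedPair M M' φ w' w → w' * C = C * w}
      add_mem' := fun {C D} hC hD w' w h => by
        rw [Matrix.mul_add, Matrix.add_mul, hC w' w h, hD w' w h]
      zero_mem' := fun w' w _ => by simp
      smul_mem' := fun r C hC w' w h => by
        rw [Matrix.mul_smul, Matrix.smul_mul, hC w' w h] }
  refine intertwines_of_stable hH hH' hHW hHW' hHM hHM' hY hY' 𝒦 ?_ ?_ ?_ ?_ ?_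
  · exact fun C hC w' w h => intertwines_sub (hC w' w h) (hC _ _ (comm w' w h).1)
  · exact fun C hC w' w h => intertwines_sub (hC w' w h) (hC _ _ (comm w' w h).2)
  · intro C hC w' w h
    obtain ⟨δ, h1, h2⟩ := h.1
    refine intertwines_sub (hC w' w h) ?_
    rw [h1, h2, Matrix.smul_mul, Matrix.mul_smul, hC w' w h]
  · exact fun C hC => hC _ _ ⟨⟨0, weight_curvature hY hW, weight_curvature hY' hW'⟩,
      fun z hz => hφ.curvature hY hW hY' hW' hz⟩
  · exact fun w' w h => h.2 0 (Metric.mem_ball_self one_pos)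

end Transport

end HomBundle

/-! ### Weights, metric adjoints and the frames in which the metrics are constant. -/

namespace HomBundle

open scoped Complex.UnitDisc ComplexConjugate

variable {m : ℕ} {d : Fin (m + 1) → ℕ} {m' : ℕ} {d' : Fin (m' + 1) → ℕ}

/-- The block scalar matrix with blocks `η + j`. -/
def weight (m : ℕ) (d : Fin (m + 1) → ℕ) (η : ℝ) : Matrix (BlockIndex m d) (BlockIndex m d) ℂ :=
  Matrix.diagonal fun p => (η : ℂ) + (p.1 : ℕ)

theorem weight_conjTranspose (η : ℝ) : (weight m d η).conjTranspose = weight m d η := by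
  rw [weight, Matrix.diagonal_conjTranspose]
  congr 1
  ext p
  simp

theorem weight_commutator_subdiagonal (η : ℝ) {Y : Matrix (BlockIndex m d) (BlockIndex m d) ℂ}
    (hY : IsBlockSubdiagonal Y) : weight m d η * Y - Y * weight m d η = Y := by
  ext p q
  rw [Matrix.sub_apply, weight, Matrix.diagonal_mul, Matrix.mul_diagonal]
  by_cases h : (p.1 : ℕ) = q.1 + 1
  · rw [h]; push_cast; ring
  · rw [hY p q h]; ring

/-- Both weights are diagonal, so the relation is a condition on each entry. It controls the
parameters and the block structure at once. -/
theorem intertwines_weight_iff (η η' : ℝ) (A : Matrix (BlockIndex m' d') (BlockIndex m d) ℂ) :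
    weight m' d' η' * A = A * weight m d η ↔
      ∀ p q, A p q = 0 ∨ η' + (p.1 : ℕ) = η + (q.1 : ℕ) := by
  rw [← Matrix.ext_iff]
  refine forall_congr' fun p => forall_congr' fun q => ?_
  rw [weight, weight, Matrix.diagonal_mul, Matrix.mul_diagonal, mul_comm, mul_eq_mul_left_iff,
    or_comm]
  norm_cast

theorem weight_comm {H : Matrix (BlockIndex m d) (BlockIndex m d) ℂ} (η : ℝ)
    (hH : IsBlockDiagonal H) : weight m d η * H = H * weight m d η := by
  rw [intertwines_weight_iff]
  intro p q
  by_cases h : (p.1 : ℕ) = q.1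
  · exact .inr (by rw [h])
  · exact .inl (hH p q h)

/-- The adjoint of `Y` with respect to `H`. -/
noncomputable def metricAdjoint (H Y : Matrix (BlockIndex m d) (BlockIndex m d) ℂ) :
    Matrix (BlockIndex m d) (BlockIndex m d) ℂ :=
  H⁻¹ * Y.conjTranspose * H

theorem mul_metricAdjoint {H : Matrix (BlockIndex m d) (BlockIndex m d) ℂ} (hH : H.PosDef)
    (Y : Matrix (BlockIndex m d) (BlockIndex m d) ℂ) :
    H * metricAdjoint H Y = Y.conjTranspose * H := by
  have h := (Matrix.isUnit_iff_isUnit_det _).1 hH.isUnit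
  rw [metricAdjoint, Matrix.mul_assoc, Matrix.mul_nonsing_inv_cancel_left _ _ h]

/-- Since `H` is block diagonal it commutes with the weight, which is therefore `H`-self-adjoint.
Taking `H`-adjoints in `[M, Y] = Y` reverses the sign. -/
theorem weight_commutator_metricAdjoint (η : ℝ)
    {H Y : Matrix (BlockIndex m d) (BlockIndex m d) ℂ} (hH : H.PosDef) (hHb : IsBlockDiagonal H)
    (hY : IsBlockSubdiagonal Y) :
    weight m d η * metricAdjoint H Y - metricAdjoint H Y * weight m d η =
      -metricAdjoint H Y := by
  apply hH.isUnit.mul_left_cancel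
  have h1 := congrArg Matrix.conjTranspose (weight_commutator_subdiagonal η hY)
  rw [Matrix.conjTranspose_sub, Matrix.conjTranspose_mul, Matrix.conjTranspose_mul,
    weight_conjTranspose] at h1
  rw [mul_neg, mul_sub, ← mul_assoc, ← weight_comm η hHb, mul_assoc, ← mul_assoc H _ (weight m d η),
    mul_metricAdjoint hH, mul_assoc Y.conjTranspose, ← weight_comm η hHb, ← mul_assoc, ← mul_assoc,
    ← sub_mul, ← neg_sub, h1, neg_mul]

/-- The matrix `exp (-z̄ Y) (1 - |z|²)^(η + j)`, which is `J_{p_z}(0)`. -/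
noncomputable def frame (η : ℝ) (Y : Matrix (BlockIndex m d) (BlockIndex m d) ℂ) (z : ℂ) :
    Matrix (BlockIndex m d) (BlockIndex m d) ℂ :=
  NormedSpace.exp ((-conj z) • Y) *
    Matrix.diagonal fun p => Complex.exp (((η : ℂ) + (p.1 : ℕ)) * Complex.log (1 - z * conj z))

/-- The inverse of `frame`. -/
noncomputable def frameInv (η : ℝ) (Y : Matrix (BlockIndex m d) (BlockIndex m d) ℂ) (z : ℂ) :
    Matrix (BlockIndex m d) (BlockIndex m d) ℂ :=
  (Matrix.diagonal fun p =>
    Complex.exp (-((η : ℂ) + (p.1 : ℕ)) * Complex.log (1 - z * conj z))) *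
      NormedSpace.exp (conj z • Y)

theorem frame_mul_frameInv (η : ℝ) (Y : Matrix (BlockIndex m d) (BlockIndex m d) ℂ) (z : ℂ) :
    frame η Y z * frameInv η Y z = 1 := by
  rw [frame, frameInv, Matrix.mul_assoc, ← Matrix.mul_assoc (Matrix.diagonal _),
    Matrix.diagonal_mul_diagonal]
  simp only [← Complex.exp_add, neg_mul, add_neg_cancel, Complex.exp_zero, Matrix.diagonal_one,
    Matrix.one_mul]
  rw [← Matrix.exp_add_of_commute, neg_smul, neg_add_cancel, NormedSpace.exp_zero]
  exact (Commute.refl Y).smul_left _ |>.smul_right _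

theorem frameInv_mul_frame (η : ℝ) (Y : Matrix (BlockIndex m d) (BlockIndex m d) ℂ) (z : ℂ) :
    frameInv η Y z * frame η Y z = 1 :=
  mul_eq_one_comm.1 (frame_mul_frameInv η Y z)

theorem frame_zero (η : ℝ) (Y : Matrix (BlockIndex m d) (BlockIndex m d) ℂ) :
    frame η Y 0 = 1 := by
  simp [frame]

/-- With `r = √(1 - |z|²)` and `D` having blocks `r ^ j`, the lower left entry of `p_z` is `z̄ / r`.
Moving one `D` past the exponential turns `D exp(-(z̄/r) Y) D` into `exp(-z̄ Y) D²`, and `D²`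
combines with `g'(0)^η = r^(2η)`. -/
theorem multiplier_lift_zero (η : ℝ) {Y : Matrix (BlockIndex m d) (BlockIndex m d) ℂ}
    (hY : IsBlockSubdiagonal Y) (z : 𝔻) : multiplier η Y (Cover.lift z) 0 = frame η Y z := by
  have hs : (0 : ℝ) < 1 - ‖(z : ℂ)‖ ^ 2 := sub_pos.2 z.sq_norm_lt_one
  have hs1 : 1 - (z : ℂ) * conj (z : ℂ) = ((1 - ‖(z : ℂ)‖ ^ 2 : ℝ) : ℂ) := by
    rw [Complex.mul_conj, Complex.normSq_eq_norm_sq]; push_cast; rfl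
  rw [multiplier, frame, hs1, ← Complex.ofReal_log hs.le]
  have hc : (Cover.lift z).base.c = (↑(√(1 - ‖(z : ℂ)‖ ^ 2))⁻¹ : ℂ) * conj (z : ℂ) := by
    simp [SU11.c, Cover.lift]
  have hd : ((Cover.lift z).base.c * ((0 : 𝔻) : ℂ) + (Cover.lift z).base.d)⁻¹ =
      (↑(√(1 - ‖(z : ℂ)‖ ^ 2)) : ℂ) := by
    simp [SU11.c, SU11.d, Cover.lift]
  have hr : (↑(√(1 - ‖(z : ℂ)‖ ^ 2)) : ℂ) ≠ 0 := by exact_mod_cast (Real.sqrt_pos.2 hs).ne'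
  rw [hd, blockPow_mul_exp hY hr, hc, Matrix.mul_assoc, blockPow_mul, ← Matrix.mul_smul]
  have hr2 : (↑(√(1 - ‖(z : ℂ)‖ ^ 2)) : ℂ) * ↑(√(1 - ‖(z : ℂ)‖ ^ 2)) =
      Complex.exp (Real.log (1 - ‖(z : ℂ)‖ ^ 2)) := by
    rw [← Complex.ofReal_exp, Real.exp_log hs, ← Complex.ofReal_mul, Real.mul_self_sqrt hs.le]
  congr 1
  · congr 2
    push_cast
    field_simp
  · rw [hr2, blockPow, ← Matrix.diagonal_smul]
    congr 1
    ext p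
    rw [Pi.smul_apply, smul_eq_mul, ← Complex.exp_nat_mul, Cover.derivPow, ← Complex.exp_add]
    congr 1
    simp [Cover.lift]
    ring

theorem metric_eq (η : ℝ) {Y : Matrix (BlockIndex m d) (BlockIndex m d) ℂ}
    (hY : IsBlockSubdiagonal Y) (H : Matrix (BlockIndex m d) (BlockIndex m d) ℂ) (z : 𝔻) :
    metric η Y H z = (frame η Y z).conjTranspose * H * frame η Y z := by
  rw [metric, multiplier_lift_zero η hY]

section Exp

open scoped Matrix.Norms.Operator

theorem hasDerivAt_exp_smul_apply (Y : Matrix (BlockIndex m d) (BlockIndex m d) ℂ) (t : ℂ)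
    (p q : BlockIndex m d) :
    HasDerivAt (fun t : ℂ => NormedSpace.exp (t • Y) p q)
      ((Y * NormedSpace.exp (t • Y)) p q) t :=
  hasDerivAt_pi.1 (hasDerivAt_pi.1 (hasDerivAt_exp_smul_const' Y t) p) q

end Exp

/-- This is the derivative at `s = 1` of the scaling identity `blockPow_mul_exp`, that is `s ^ j ·
exp(tY) = exp(stY) · s ^ j`; the scalar `η` contributes equally to both sides. -/
theorem weight_mul_exp (η : ℝ) {Y : Matrix (BlockIndex m d) (BlockIndex m d) ℂ}
    (hY : IsBlockSubdiagonal Y) (t : ℂ) :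
    weight m d η * NormedSpace.exp (t • Y) =
      t • (Y * NormedSpace.exp (t • Y)) + NormedSpace.exp (t • Y) * weight m d η := by
  ext p q
  have h1 : HasDerivAt (fun s : ℂ => s ^ (p.1 : ℕ) * NormedSpace.exp (t • Y) p q)
      ((p.1 : ℕ) * NormedSpace.exp (t • Y) p q) 1 := by
    simpa using (hasDerivAt_pow (p.1 : ℕ) (1 : ℂ)).mul_const (NormedSpace.exp (t • Y) p q)
  have h2 : HasDerivAt (fun s : ℂ => NormedSpace.exp ((s * t) • Y) p q * s ^ (q.1 : ℕ))
      (t * (Y * NormedSpace.exp (t • Y)) p q + NormedSpace.exp (t • Y) p q * (q.1 : ℕ)) 1 := by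
    have h3 : HasDerivAt (fun s : ℂ => s * t) t 1 := by
      simpa using (hasDerivAt_id (1 : ℂ)).mul_const t
    have h4 := (hasDerivAt_exp_smul_apply Y (1 * t) p q).comp (1 : ℂ) h3
    refine (h4.mul (hasDerivAt_pow (q.1 : ℕ) (1 : ℂ))).congr_deriv ?_
    simp [mul_comm]
  have h5 : (fun s : ℂ => s ^ (p.1 : ℕ) * NormedSpace.exp (t • Y) p q) =ᶠ[nhds 1]
      fun s : ℂ => NormedSpace.exp ((s * t) • Y) p q * s ^ (q.1 : ℕ) := by
    filter_upwards [isOpen_ne.mem_nhds (one_ne_zero (α := ℂ))] with s hs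
    have := congrFun (congrFun (blockPow_mul_exp hY hs t) p) q
    rwa [blockPow, Matrix.diagonal_mul, Matrix.mul_diagonal] at this
  have h6 := h1.unique (h2.congr_of_eventuallyEq h5)
  rw [Matrix.add_apply, Matrix.smul_apply, smul_eq_mul, weight, Matrix.diagonal_mul,
    Matrix.mul_diagonal]
  linear_combination h6

theorem hasWirtingerAt_exp_conj_smul (Y : Matrix (BlockIndex m d) (BlockIndex m d) ℂ) (ε z : ℂ) :
    MatrixHasWirtingerAt (fun w => NormedSpace.exp ((ε * conj w) • Y)) 0
      (ε • (Y * NormedSpace.exp ((ε * conj z) • Y))) z := by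
  intro p q
  have h : HasWirtingerAt (fun w => ε * conj w) 0 ε z := by
    simpa using (HasWirtingerAt.const ε).mul HasWirtingerAt.id.star
  have := HasDerivAt.comp_hasWirtingerAt (f := fun w => ε * conj w)
    (hasDerivAt_exp_smul_apply Y _ p q) h
  simpa [mul_comm] using this

theorem hasWirtingerAt_diagonal_exp {α : Type*} [DecidableEq α] (a : α → ℂ) {z : ℂ}
    (hz : z ∈ Metric.ball (0 : ℂ) 1) :
    MatrixHasWirtingerAt
      (fun w => Matrix.diagonal fun p => Complex.exp (a p * Complex.log (1 - w * conj w)))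
      (Matrix.diagonal fun p => Complex.exp (a p * Complex.log (1 - z * conj z)) *
        (a p * ((1 - z * conj z)⁻¹ * -conj z)))
      (Matrix.diagonal fun p => Complex.exp (a p * Complex.log (1 - z * conj z)) *
        (a p * ((1 - z * conj z)⁻¹ * -z))) z := by
  have hs : 1 - z * conj z ∈ Complex.slitPlane := by
    rw [sub_eq_add_neg]
    refine Complex.mem_slitPlane_of_norm_lt_one ?_
    rw [norm_neg, norm_mul, RCLike.norm_conj]
    have := mem_ball_zero_iff.1 hz
    nlinarith [norm_nonneg z]
  have h1 := HasDerivAt.comp_hasWirtingerAt (f := fun w => 1 - w * conj w)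
    (Complex.hasDerivAt_log hs) (hasWirtingerAt_one_sub_mul_conj z)
  intro p q
  by_cases hpq : p = q
  · subst hpq
    have h2 := (HasWirtingerAt.const (a p)).mul h1
    have h3 := HasDerivAt.comp_hasWirtingerAt
      (f := fun w => a p * Complex.log (1 - w * conj w)) (Complex.hasDerivAt_exp _) h2
    simpa using h3
  · simpa [hpq] using HasWirtingerAt.const (z := z) 0

/-- Only the `∂̄` derivative is made explicit; the isometry condition later determines the `∂`
derivative of the whole product. -/
theorem frame_hasWirtingerAt (η : ℝ) {Y : Matrix (BlockIndex m d) (BlockIndex m d) ℂ}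
    (hY : IsBlockSubdiagonal Y) {z : ℂ} (hz : z ∈ Metric.ball (0 : ℂ) 1) :
    ∃ P, MatrixHasWirtingerAt (frame η Y) P
      (-((1 - z * conj z)⁻¹ • ((Y + z • weight m d η) * frame η Y z))) z := by
  have h1 := hasWirtingerAt_exp_conj_smul Y (-1) z
  simp only [neg_one_mul] at h1
  have h2 := hasWirtingerAt_diagonal_exp (fun p : BlockIndex m d => (η : ℂ) + (p.1 : ℕ)) hz
  have h3 := h1.mul h2
  refine ⟨_, h3.congr_right ?_⟩
  have e : (Matrix.diagonal fun p : BlockIndex m d =>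
      Complex.exp (((η : ℂ) + (p.1 : ℕ)) * Complex.log (1 - z * conj z)) *
        (((η : ℂ) + (p.1 : ℕ)) * ((1 - z * conj z)⁻¹ * -z))) =
      (-((1 - z * conj z)⁻¹ * z)) • (weight m d η * Matrix.diagonal fun p : BlockIndex m d =>
        Complex.exp (((η : ℂ) + (p.1 : ℕ)) * Complex.log (1 - z * conj z))) := by
    rw [weight, Matrix.diagonal_mul_diagonal, ← Matrix.diagonal_smul]
    congr 1
    ext p
    simp only [Pi.smul_apply, smul_eq_mul]
    ring
  have e2 : NormedSpace.exp ((-conj z) • Y) * weight m d η =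
      weight m d η * NormedSpace.exp ((-conj z) • Y) +
        conj z • (Y * NormedSpace.exp ((-conj z) • Y)) := by
    rw [weight_mul_exp η hY]; module
  have ht : (1 - z * conj z)⁻¹ * (1 - z * conj z) = 1 :=
    inv_mul_cancel₀ (one_sub_mul_conj_ne_zero hz)
  rw [e, frame, Matrix.mul_smul, ← Matrix.mul_assoc _ (weight m d η), e2]
  simp only [Matrix.add_mul, Matrix.smul_mul, Matrix.mul_assoc]
  -- With `t = (1 - z z̄)⁻¹`, the coefficient of `Y` is correct because `1 + t z z̄ = t`.
  match_scalars
  · linear_combination -ht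
  · ring

/-- The product rule is needed only for differentiability; the value comes from `∂̄` of `frameInv *
frame = 1`. -/
theorem frameInv_hasWirtingerAt (η : ℝ) {Y : Matrix (BlockIndex m d) (BlockIndex m d) ℂ}
    (hY : IsBlockSubdiagonal Y) {z : ℂ} (hz : z ∈ Metric.ball (0 : ℂ) 1) :
    ∃ P, MatrixHasWirtingerAt (frameInv η Y) P
      ((1 - z * conj z)⁻¹ • (frameInv η Y z * (Y + z • weight m d η))) z := by
  have h1 := hasWirtingerAt_exp_conj_smul Y 1 z
  simp only [one_mul] at h1
  have h2 := hasWirtingerAt_diagonal_exp (fun p : BlockIndex m d => -((η : ℂ) + (p.1 : ℕ))) hz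
  have h3 : MatrixHasWirtingerAt (frameInv η Y) _ _ z := h2.mul h1
  obtain ⟨P, hP⟩ := frame_hasWirtingerAt η hY hz
  have h4 := h3.mul hP
  simp only [frameInv_mul_frame] at h4
  have h5 := (h4.unique (.const 1)).2
  refine ⟨_, h3.congr_right ?_⟩
  have h6 := congrArg (fun X => X * frameInv η Y z) h5
  simp only [Matrix.add_mul, Matrix.mul_assoc, Matrix.mul_neg, Matrix.neg_mul, Matrix.mul_smul,
    Matrix.smul_mul, frame_mul_frameInv, Matrix.mul_one, Matrix.zero_mul] at h6
  rw [add_neg_eq_zero] at h6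
  simp only [Matrix.mul_add, Matrix.mul_smul] at h6 ⊢
  exact h6.symm

end HomBundle

/-! ### From an isometric isomorphism to the intertwining relations at the origin. -/

namespace HomBundle

open scoped Complex.UnitDisc ComplexConjugate

variable {m : ℕ} {d : Fin (m + 1) → ℕ} {m' : ℕ} {d' : Fin (m' + 1) → ℕ}
  {η η' : ℝ} {Y H : Matrix (BlockIndex m d) (BlockIndex m d) ℂ}
  {Y' H' : Matrix (BlockIndex m' d') (BlockIndex m' d') ℂ}

/-- If `φ` is isometric for constant metrics and `∂̄φ = t (φ A - A' φ)`, then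
`∂φ = t̄ (A'^* φ - φ A^*)`, where `A^*` and `A'^*` are the adjoints of `A` and `A'`. -/
theorem wirtinger_eq_of_isometric {ι κ : Type*} [Fintype ι] [Fintype κ]
    [DecidableEq ι] [DecidableEq κ] {H A B : Matrix ι ι ℂ} {H' A' B' : Matrix κ κ ℂ}
    {φ : ℂ → Matrix κ ι ℂ} {P : Matrix κ ι ℂ} {X : Matrix ι κ ℂ} {z t : ℂ}
    (hH' : IsUnit H') (hB : H * B = A.conjTranspose * H) (hB' : H' * B' = A'.conjTranspose * H')
    (hφ : ∀ᶠ w in nhds z, (φ w).conjTranspose * H' * φ w = H) (hX : φ z * X = 1)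
    (hd : MatrixHasWirtingerAt φ P (t • (φ z * A - A' * φ z)) z) :
    P = conj t • (B' * φ z - φ z * B) := by
  -- Applying `∂` to `φᴴ H' φ = H` gives `φᴴ H' P = -(∂̄φ)ᴴ H' φ`; the adjoint relations rewrite the
  -- right side, and then `φᴴ` and `H'` are cancelled on the left.
  have h1 := ((hd.conjTranspose.mul_const H').mul hd).congr_of_eventuallyEq
    (g := fun _ => H) (hφ.mono fun w hw => hw.symm)
  have h2 := (h1.unique (.const H)).1
  have hz := hφ.self_of_nhds
  have hX' : X.conjTranspose * (φ z).conjTranspose = 1 := by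
    rw [← Matrix.conjTranspose_mul, hX, Matrix.conjTranspose_one]
  have h3 : (φ z).conjTranspose * (H' * P) =
      (φ z).conjTranspose * (H' * (conj t • (B' * φ z - φ z * B))) := by
    have e1 := congrArg (fun Z => (φ z).conjTranspose * Z * φ z) hB'
    have e2 : (φ z).conjTranspose * (H' * (φ z * B)) =
        A.conjTranspose * ((φ z).conjTranspose * (H' * φ z)) := by
      rw [← Matrix.mul_assoc, ← Matrix.mul_assoc, hz, hB, ← Matrix.mul_assoc _ H', hz]
    simp only [Matrix.conjTranspose_smul, Matrix.conjTranspose_sub, Matrix.conjTranspose_mul,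
      Matrix.sub_mul, Matrix.mul_sub, Matrix.smul_mul, Matrix.mul_smul, Matrix.mul_assoc,
      Complex.star_def] at h2 e1 ⊢
    linear_combination (norm := module) h2 - conj t • e1 + conj t • e2
  have h4 := congrArg (fun Z => X.conjTranspose * Z) h3
  simp only [← Matrix.mul_assoc X.conjTranspose, hX', Matrix.one_mul] at h4
  obtain ⟨G', hG⟩ := hH'.exists_left_inv
  have h5 := congrArg (fun Z => G' * Z) h4
  simpa only [← Matrix.mul_assoc G', hG, Matrix.one_mul] using h5

/-- The matrix-valued function `φ = h' Φ h⁻¹` that an isometric isomorphism `Φ` becomes in the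
frames in which the metrics are constant is parallel. -/
theorem isParallel_of_isometric (hY : IsBlockSubdiagonal Y) (hH : H.PosDef)
    (hHb : IsBlockDiagonal H) (hY' : IsBlockSubdiagonal Y') (hH' : H'.PosDef)
    (hHb' : IsBlockDiagonal H') {F : ℂ → Matrix (BlockIndex m' d') (BlockIndex m d) ℂ}
    (hF : ∀ p q, DifferentiableOn ℂ (fun z => F z p q) (Metric.ball 0 1))
    (hinv : ∀ z ∈ Metric.ball (0 : ℂ) 1,
      ∃ G : Matrix (BlockIndex m d) (BlockIndex m' d') ℂ, F z * G = 1)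
    (hiso : ∀ z ∈ Metric.ball (0 : ℂ) 1,
      (F z).conjTranspose * ((frame η' Y' z).conjTranspose * H' * frame η' Y' z) * F z =
        (frame η Y z).conjTranspose * H * frame η Y z) :
    IsParallel (weight m d η) Y (metricAdjoint H Y) (weight m' d' η') Y' (metricAdjoint H' Y')
      fun z => frame η' Y' z * F z * frameInv η Y z := by
  intro z hz
  have hFd : MatrixHasWirtingerAt F (.of fun p q => deriv (fun z => F z p q) z) 0 z := by
    intro p q
    have h := HasDerivAt.comp_hasWirtingerAt (f := fun w => w)
      ((hF p q).differentiableAt (eventually_mem_ball hz)).hasDerivAt HasWirtingerAt.id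
    simpa using h
  obtain ⟨P₁, hP₁⟩ := frame_hasWirtingerAt η' hY' hz
  obtain ⟨P₂, hP₂⟩ := frameInv_hasWirtingerAt η hY hz
  have hd := (hP₁.mul hFd).mul hP₂
  obtain ⟨G, hG⟩ := hinv z hz
  have hd' := hd.congr_right (Q' := (1 - z * conj z)⁻¹ •
    ((frame η' Y' z * F z * frameInv η Y z) * (Y + z • weight m d η) -
      (Y' + z • weight m' d' η') * (frame η' Y' z * F z * frameInv η Y z))) (by
    simp only [Matrix.mul_zero, add_zero, Matrix.neg_mul, Matrix.smul_mul, Matrix.mul_smul,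
      Matrix.mul_assoc]
    module)
  -- As the weight is `H`-self-adjoint, the adjoint of `Y + zM` is `W + z̄M`. The scalar `(1 - z
  -- z̄)⁻¹` is real, so its conjugation has no effect.
  have hP := wirtinger_eq_of_isometric (H := H) (A := Y + z • weight m d η)
    (B := metricAdjoint H Y + conj z • weight m d η) (H' := H') (A' := Y' + z • weight m' d' η')
    (B' := metricAdjoint H' Y' + conj z • weight m' d' η')
    (φ := fun z => frame η' Y' z * F z * frameInv η Y z)
    (X := frame η Y z * G * frameInv η' Y' z) hH'.isUnit ?_ ?_ ?_ ?_ hd'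
  · have ht : conj (1 - z * conj z)⁻¹ = (1 - z * conj z)⁻¹ := by
      simp [mul_comm]
    rw [hP, ht] at hd'
    exact hd'
  · rw [Matrix.mul_add, mul_metricAdjoint hH, Matrix.mul_smul, ← weight_comm η hHb,
      Matrix.conjTranspose_add, Matrix.conjTranspose_smul, weight_conjTranspose, Matrix.add_mul,
      Matrix.smul_mul, Complex.star_def]
  · rw [Matrix.mul_add, mul_metricAdjoint hH', Matrix.mul_smul, ← weight_comm η' hHb',
      Matrix.conjTranspose_add, Matrix.conjTranspose_smul, weight_conjTranspose, Matrix.add_mul,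
      Matrix.smul_mul, Complex.star_def]
  · filter_upwards [eventually_mem_ball hz] with w hw
    have h := congrArg (fun Z => (frameInv η Y w).conjTranspose * Z * frameInv η Y w) (hiso w hw)
    have e : (frameInv η Y w).conjTranspose * (frame η Y w).conjTranspose = 1 := by
      rw [← Matrix.conjTranspose_mul, frame_mul_frameInv, Matrix.conjTranspose_one]
    simp only [Matrix.mul_assoc, frame_mul_frameInv, Matrix.mul_one] at h
    rw [← Matrix.mul_assoc _ _ H, e, Matrix.one_mul] at h
    simpa only [Matrix.conjTranspose_mul, Matrix.mul_assoc] using h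
  · calc frame η' Y' z * F z * frameInv η Y z * (frame η Y z * G * frameInv η' Y' z)
        = frame η' Y' z * (F z * ((frameInv η Y z * frame η Y z) * G)) * frameInv η' Y' z := by
          simp only [Matrix.mul_assoc]
      _ = 1 := by
          rw [frameInv_mul_frame, Matrix.one_mul, hG, Matrix.mul_one, frame_mul_frameInv]

/-- An isometric isomorphism intertwines the data of the bundles at the origin. -/
theorem intertwines_of_isometricIso (hY : IsBlockSubdiagonal Y) (hH : H.PosDef)
    (hHb : IsBlockDiagonal H) (hY' : IsBlockSubdiagonal Y') (hH' : H'.PosDef)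
    (hHb' : IsBlockDiagonal H') {Φ : 𝔻 → Matrix (BlockIndex m' d') (BlockIndex m d) ℂ}
    (hΦ : HermBundle.IsIsometricIso (bundle η Y H hY hH hHb) (bundle η' Y' H' hY' hH' hHb') Φ) :
    Y' * Φ 0 = Φ 0 * Y ∧ weight m' d' η' * Φ 0 = Φ 0 * weight m d η := by
  obtain ⟨hholo, hinv, hiso⟩ := hΦ
  choose F hF hFΦ using hholo
  have hFΦ' : ∀ z : 𝔻, Matrix.of (fun p q => F p q z) = Φ z := fun z => by
    ext p q
    exact hFΦ p q z
  have h0 := hFΦ' 0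
  rw [Complex.UnitDisc.coe_zero] at h0
  have h := (isParallel_of_isometric (η := η) (η' := η') hY hH hHb hY' hH' hHb'
    (F := fun z => .of fun p q => F p q z) hF ?_ ?_).intertwines hH hH'
    (mul_metricAdjoint hH Y) (mul_metricAdjoint hH' Y')
    (by rw [weight_conjTranspose, weight_comm η hHb])
    (by rw [weight_conjTranspose, weight_comm η' hHb'])
    (weight_commutator_subdiagonal η hY) (weight_commutator_metricAdjoint η hH hHb hY)
    (weight_commutator_subdiagonal η' hY') (weight_commutator_metricAdjoint η' hH' hHb' hY')
  · have e : frameInv η Y 0 = 1 := by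
      have := frame_mul_frameInv η Y 0
      rwa [frame_zero, Matrix.one_mul] at this
    simpa only [frame_zero, e, Matrix.one_mul, Matrix.mul_one, h0] using h
  · intro z hz
    obtain ⟨G, -, hG⟩ := hinv (.mk z (mem_ball_zero_iff.1 hz))
    rw [← hFΦ'] at hG
    exact ⟨G, hG⟩
  · intro z hz
    have h := hiso (.mk z (mem_ball_zero_iff.1 hz))
    rw [← hFΦ'] at h
    simp only [bundle, metric_eq η hY, metric_eq η' hY', Complex.UnitDisc.coe_mk] at h
    exact h

/-! ### From intertwiners of the data to homogeneous isometries. -/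

section Exp

open scoped Matrix.Norms.Operator

theorem exp_smul_intertwines {ι κ : Type*} [Fintype ι] [Fintype κ] [DecidableEq ι]
    [DecidableEq κ] {X : Matrix ι ι ℂ} {X' : Matrix κ κ ℂ} {A : Matrix κ ι ℂ}
    (h : X' * A = A * X) : NormedSpace.exp X' * A = A * NormedSpace.exp X := by
  have hpow : ∀ n : ℕ, X' ^ n * A = A * X ^ n := by
    intro n
    induction n with
    | zero => simp
    | succ n ih => rw [pow_succ, pow_succ, Matrix.mul_assoc, h, ← Matrix.mul_assoc, ih,
        Matrix.mul_assoc]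
  have h1 := (NormedSpace.exp_series_hasSum_exp' (𝕂 := ℂ) X').map
    (AddMonoidHom.mk' (fun Z : Matrix κ κ ℂ => Z * A) fun Z W => Matrix.add_mul Z W A)
    (continuous_id.matrix_mul continuous_const)
  have h2 := (NormedSpace.exp_series_hasSum_exp' (𝕂 := ℂ) X).map
    (AddMonoidHom.mk' (fun Z : Matrix ι ι ℂ => A * Z) fun Z W => Matrix.mul_add A Z W)
    (continuous_const.matrix_mul continuous_id)
  refine h1.unique ?_
  convert h2 using 1
  · ext1 n
    simp [hpow]
  · rfl

end Exp

theorem blockPow_mul_blockDiagonal {A : Matrix (BlockIndex m' d') (BlockIndex m d) ℂ}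
    (hA : IsBlockDiagonal A) (s : ℂ) : blockPow m' d' s * A = A * blockPow m d s := by
  ext p q
  rw [blockPow, blockPow, Matrix.diagonal_mul, Matrix.mul_diagonal]
  by_cases h : (p.1 : ℕ) = q.1
  · rw [h, mul_comm]
  · rw [hA p q h]; ring

/-- A block diagonal `A` passes through the block scalar factors `D_g`, and `Y' A = A Y` passes
through the exponential; the factor `g'(z)^η` is the same for both bundles. -/
theorem multiplier_intertwines {A : Matrix (BlockIndex m' d') (BlockIndex m d) ℂ}
    (hA : IsBlockDiagonal A) (h : Y' * A = A * Y) (g : Cover) (z : 𝔻) :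
    multiplier η Y' g z * A = A * multiplier η Y g z := by
  have he : NormedSpace.exp (-g.base.c • Y') * A = A * NormedSpace.exp (-g.base.c • Y) :=
    exp_smul_intertwines (by rw [Matrix.smul_mul, h, Matrix.mul_smul])
  rw [multiplier, multiplier, Matrix.smul_mul, Matrix.mul_smul, Matrix.mul_assoc,
    blockPow_mul_blockDiagonal hA, ← Matrix.mul_assoc, Matrix.mul_assoc (blockPow _ _ _), he,
    ← Matrix.mul_assoc, blockPow_mul_blockDiagonal hA]
  simp only [Matrix.mul_assoc]

/-- An invertible block diagonal matrix that intertwines the data of two bundles is an isometric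
equivariant isomorphism between them. -/
theorem homogeneousIsomorphic_of_intertwines (hY : IsBlockSubdiagonal Y) (hH : H.PosDef)
    (hHb : IsBlockDiagonal H) (hY' : IsBlockSubdiagonal Y') (hH' : H'.PosDef)
    (hHb' : IsBlockDiagonal H') {A : Matrix (BlockIndex m' d') (BlockIndex m d) ℂ}
    {B : Matrix (BlockIndex m d) (BlockIndex m' d') ℂ} (hA : IsBlockDiagonal A) (hAB : A * B = 1)
    (hBA : B * A = 1) (hYA : Y' * A = A * Y) (hHA : A.conjTranspose * H' * A = H) :
    (bundle η Y H hY hH hHb).HomogeneousIsomorphic (bundle η Y' H' hY' hH' hHb') := by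
  refine ⟨fun _ => A, ⟨fun p q => ⟨fun _ => A p q, by fun_prop, fun _ => rfl⟩,
    fun _ => ⟨B, hBA, hAB⟩, fun z => ?_⟩, fun g z => multiplier_intertwines hA hYA g z⟩
  -- The metric over `z` is transported from the origin by the multiplier of `p_z`, so isometry
  -- there reduces to `hHA`.
  have h := multiplier_intertwines (η := η) hA hYA (Cover.lift z) 0
  have h' := congrArg Matrix.conjTranspose h
  rw [Matrix.conjTranspose_mul, Matrix.conjTranspose_mul] at h'
  show A.conjTranspose * metric η Y' H' z * A = metric η Y H z
  rw [metric, metric, ← hHA]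
  simp only [Matrix.mul_assoc] at h h' ⊢
  rw [h, ← Matrix.mul_assoc, h']
  simp only [Matrix.mul_assoc]

/-! ### Recovery of `η` and the grading, and the equivalence. -/

/-- The parameter `η` and the grading are determined by the weights. -/
theorem eq_and_isBlockDiagonal_of_intertwines_weight (hd : 0 < d 0) (hd' : 0 < d' 0)
    {A : Matrix (BlockIndex m' d') (BlockIndex m d) ℂ}
    {B : Matrix (BlockIndex m d) (BlockIndex m' d') ℂ} (hAB : A * B = 1) (hBA : B * A = 1)
    (hA : weight m' d' η' * A = A * weight m d η) : η = η' ∧ IsBlockDiagonal A := by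
  rw [intertwines_weight_iff] at hA
  -- If `η < η'`, then `η' + p = η` has no solution `p ≥ 0`, so the columns of `A` from block `0`
  -- vanish, contradicting `B A = 1`. The reverse inequality uses the rows of block `0` and `A B =
  -- 1`. Only the lowest blocks have to be nonempty.
  have h1 : η' ≤ η := by
    by_contra! hlt
    have h := congrFun (congrFun hBA ⟨0, ⟨0, hd⟩⟩) ⟨0, ⟨0, hd⟩⟩
    rw [Matrix.mul_apply, Finset.sum_eq_zero, Matrix.one_apply_eq] at h
    · exact zero_ne_one h
    · intro p _
      rw [(hA p _).resolve_right, mul_zero]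
      have : (0 : ℝ) ≤ (p.1 : ℕ) := Nat.cast_nonneg _
      simp only [Fin.val_zero, Nat.cast_zero]
      linarith
  have h2 : η ≤ η' := by
    by_contra! hlt
    have h := congrFun (congrFun hAB ⟨0, ⟨0, hd'⟩⟩) ⟨0, ⟨0, hd'⟩⟩
    rw [Matrix.mul_apply, Finset.sum_eq_zero, Matrix.one_apply_eq] at h
    · exact zero_ne_one h
    · intro q _
      rw [(hA _ q).resolve_right, zero_mul]
      have : (0 : ℝ) ≤ (q.1 : ℕ) := Nat.cast_nonneg _
      simp only [Fin.val_zero, Nat.cast_zero]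
      linarith
  refine ⟨le_antisymm h2 h1, fun p q hpq => (hA p q).resolve_right fun h => hpq ?_⟩
  have : ((p.1 : ℕ) : ℝ) = (q.1 : ℕ) := by linarith
  exact_mod_cast this

end HomBundle

/-- For the elementary bundles `(E^(η,Y), H)` and `(E^(η',Y'), H')` with blocks of sizes
`d_0, …, d_m ≥ 1` and `d'_0, …, d'_{m'} ≥ 1`, the following are equivalent: they are isomorphic as
homogeneous holomorphic Hermitian bundles; they are isomorphic as holomorphic Hermitian bundles;
`η = η'` and `Y' = A Y A⁻¹`, `H' = (A⁻¹)^* H A⁻¹` for an invertible block diagonal `A`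
(whose inverse is called `B`). -/
theorem mainTheorem10
    (m : ℕ) (d : Fin (m + 1) → ℕ) (hd : ∀ j, 0 < d j)
    (η : ℝ) (Y H : Matrix (HomBundle.BlockIndex m d) (HomBundle.BlockIndex m d) ℂ)
    (hY : HomBundle.IsBlockSubdiagonal Y) (hH : H.PosDef) (hHb : HomBundle.IsBlockDiagonal H)
    (m' : ℕ) (d' : Fin (m' + 1) → ℕ) (hd' : ∀ j, 0 < d' j)
    (η' : ℝ) (Y' H' : Matrix (HomBundle.BlockIndex m' d') (HomBundle.BlockIndex m' d') ℂ)
    (hY' : HomBundle.IsBlockSubdiagonal Y') (hH' : H'.PosDef)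
    (hHb' : HomBundle.IsBlockDiagonal H') :
    List.TFAE
      [ (HomBundle.bundle η Y H hY hH hHb).HomogeneousIsomorphic
          (HomBundle.bundle η' Y' H' hY' hH' hHb'),
        (HomBundle.bundle η Y H hY hH hHb).HermitianIsomorphic
          (HomBundle.bundle η' Y' H' hY' hH' hHb'),
        η = η' ∧
          ∃ (A : Matrix (HomBundle.BlockIndex m' d') (HomBundle.BlockIndex m d) ℂ)
            (B : Matrix (HomBundle.BlockIndex m d) (HomBundle.BlockIndex m' d') ℂ),
            HomBundle.IsBlockDiagonal A ∧ A * B = 1 ∧ B * A = 1 ∧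
            Y' = A * Y * B ∧ H' = B.conjTranspose * H * B ] := by
  tfae_have 1 → 2 := fun ⟨Φ, hΦ, _⟩ => ⟨Φ, hΦ⟩
  tfae_have 2 → 3 := by
    rintro ⟨Φ, hΦ⟩
    -- The matrix sought is the value of the isomorphism over the origin, where the two metrics are
    -- `H` and `H'`.
    obtain ⟨hYA, hwA⟩ := HomBundle.intertwines_of_isometricIso hY hH hHb hY' hH' hHb' hΦ
    obtain ⟨B, hBA, hAB⟩ := hΦ.2.1 0
    have hHA : (Φ 0).conjTranspose * H' * Φ 0 = H := by
      have h := hΦ.2.2 0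
      simp only [HomBundle.bundle, HomBundle.metric_zero η Y hHb,
        HomBundle.metric_zero η' Y' hHb'] at h
      exact h
    obtain ⟨hη, hA⟩ := HomBundle.eq_and_isBlockDiagonal_of_intertwines_weight (hd 0) (hd' 0)
      hAB hBA hwA
    refine ⟨hη, Φ 0, B, hA, hAB, hBA, ?_, ?_⟩
    · rw [← hYA, Matrix.mul_assoc, hAB, Matrix.mul_one]
    · rw [← hHA]
      simp only [Matrix.mul_assoc, hAB, Matrix.mul_one]
      rw [← Matrix.mul_assoc, ← Matrix.conjTranspose_mul, hAB, Matrix.conjTranspose_one,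
        Matrix.one_mul]
  tfae_have 3 → 1 := by
    rintro ⟨rfl, A, B, hA, hAB, hBA, rfl, rfl⟩
    refine HomBundle.homogeneousIsomorphic_of_intertwines hY hH hHb hY' hH' hHb' hA hAB hBA ?_ ?_
    · rw [Matrix.mul_assoc, hBA, Matrix.mul_one]
    · simp only [Matrix.mul_assoc, hBA, Matrix.mul_one]
      rw [← Matrix.mul_assoc, ← Matrix.conjTranspose_mul, hBA, Matrix.conjTranspose_one,
        Matrix.one_mul]
  tfae_finish
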